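/- Fermat reals. Let $E$ be a finite-dimensional real normed space. A little-oh polynomial in $E$ is a function $x:[0,\epsilon)\to E$ (some $\epsilon>0$) such that $x(t)=x(0)+\sum_{i=1}^{k}\alpha_i t^{a_i}+o(t)$ as $t\to0^+$ for some $k\in\mathbb{N}$, $\alpha_i\in E$ and real $a_i>0$. Two of them are equivalent if $x(0)=y(0)$ and $x(t)-y(t)=o(t)$ as $t\to0^+$; the set of classes is ${}^{\bullet}E$. For $x\in{}^{\bullet}E$ write ${}^{\circ}x=x(0)$ for its standard part and $\delta x=x-{}^{\circ}x$ for its infinitesimal part; for an open set $U\subseteq E$ put ${}^{\bullet}U=\{x\in{}^{\bullet}E:{}^{\circ}x\in U\}$. Identify ${}^{\bullet}E\times{}^{\bullet}F$ with ${}^{\bullet}(E\times F)$. A smooth map $f:U\to F$ extends to ${}^{\bullet}f:{}^{\bullet}U\to{}^{\bullet}F$, ${}^{\bullet}f([x])=[f\circ x]$. Any $x,y\in{}^{\bullet}\mathbb{R}$ can be written as $x={}^{\circ}x+\sum_{i=1}^n\alpha_i t^{a_i}$ and $y={}^{\circ}y+\sum_{i=1}^n\beta_i t^{a_i}$ with common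 exponents $0<a_1<\dots<a_n\le1$; ${}^{\bullet}\mathbb{R}$ is totally ordered by letting $x\le y$ if $({}^{\circ}x,\alpha_1,\dots,\alpha_n)\le({}^{\circ}y,\beta_1,\dots,\beta_n)$ in the dictionary order. A function $g:{}^{\bullet}U\to{}^{\bullet}\mathbb{R}$, with $U\subseteq\mathbb{R}$ open and connected, has the intermediate value property if for all $a<b$ in ${}^{\bullet}U$ and every $y\in{}^{\bullet}\mathbb{R}$ strictly between $g(a)$ and $g(b)$ there is $c\in{}^{\bullet}U$ with $a<c<b$ and $g(c)=y$. Proposition. Let $U\subseteq\mathbb{R}$ be open and connected, let $V\subseteq\mathbb{R}^d$ be open, let $h:V\times U\to\mathbb{R}$ be smooth, let $v\in{}^{\bullet}V$ with $\delta v\neq0$, and define $g:{}^{\bullet}U\to{}^{\bullet}\mathbb{R}$ by $g(x)={}^{\bullet}h(v,x)$. Assume that for each $x\in{}^{\bullet}U$ there is an integer $m>0$ with $D^{(0,m)}h({}^{\circ}v,{}^{\circ}x)\neq0$, and let $m_x$ be the smallest such $m$. Assume further that for every $x\in{}^{\bullet}U$ one has $D^{(a_v,a_x)}h({}^{\circ}v,{}^{\circ}x)=0$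 for all multi-indices $a_v\in\mathbb{N}^d$ and all integers $a_x$ with $0<a_x<m_x$. Then $g$ has the intermediate value property. -/

import Mathlib

open Filter Topology Asymptotics Set
open scoped ContDiff

noncomputable section

section LittleOh

variable {E F : Type*} [NormedAddCommGroup E] [NormedSpace ℝ E]
  [NormedAddCommGroup F] [NormedSpace ℝ F]

/-- Little-oh polynomials with values in a normed space `E`:
`x t = x 0 + ∑ i, t ^ (a i) • α i + o(t)` as `t → 0⁺`, with finitely many exponents `a i > 0`.
Only the values of `x` on some `[0, ε)` matter, so `x` is taken as a function on all of `ℝ`. -/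
def IsLittleOhPoly (x : ℝ → E) : Prop :=
  ∃ (k : ℕ) (α : Fin k → E) (a : Fin k → ℝ), (∀ i, 0 < a i) ∧
    (fun t : ℝ => x t - x 0 - ∑ i, t ^ (a i) • α i) =o[𝓝[>] 0] (fun t : ℝ => t)

/-- The finite set indexing the monomials may be any finite type. -/
theorem IsLittleOhPoly.of_fintype {ι : Type*} [Fintype ι] {x : ℝ → E} (α : ι → E) (a : ι → ℝ)
    (ha : ∀ i, 0 < a i)
    (h : (fun t : ℝ => x t - x 0 - ∑ i, t ^ (a i) • α i) =o[𝓝[>] 0] (fun t : ℝ => t)) :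
    IsLittleOhPoly x := by
  refine ⟨Fintype.card ι, α ∘ (Fintype.equivFin ι).symm, a ∘ (Fintype.equivFin ι).symm,
    fun i => ha _, ?_⟩
  refine h.congr_left fun t => ?_
  congr 1
  exact (Equiv.sum_comp (Fintype.equivFin ι).symm (fun i => t ^ (a i) • α i)).symm

theorem isLittleOhPoly_const (r : E) : IsLittleOhPoly (fun _ : ℝ => r) :=
  ⟨0, Fin.elim0, Fin.elim0, fun i => i.elim0, by simp⟩

theorem isLittleOhPoly_sum (r : E) {k : ℕ} (α : Fin k → E) (a : Fin k → ℝ) (ha : ∀ i, 0 < a i) :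
    IsLittleOhPoly (fun t : ℝ => r + ∑ i, t ^ (a i) • α i) := by
  refine ⟨k, α, a, ha, ?_⟩
  have h0 : ∑ i, (0 : ℝ) ^ (a i) • α i = 0 :=
    Finset.sum_eq_zero fun i _ => by rw [Real.zero_rpow (ha i).ne', zero_smul]
  simp [h0]

theorem IsLittleOhPoly.sub_zero_val {x : ℝ → E} (hx : IsLittleOhPoly x) :
    IsLittleOhPoly (fun t => x t - x 0) := by
  obtain ⟨k, α, a, ha, h⟩ := hx
  exact ⟨k, α, a, ha, by simpa using h⟩

theorem IsLittleOhPoly.prodMk {x : ℝ → E} {y : ℝ → F} (hx : IsLittleOhPoly x)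
    (hy : IsLittleOhPoly y) : IsLittleOhPoly (fun t => (x t, y t)) := by
  obtain ⟨k, α, a, ha, h⟩ := hx
  obtain ⟨l, β, b, hb, h'⟩ := hy
  refine IsLittleOhPoly.of_fintype (ι := Fin k ⊕ Fin l)
    (Sum.elim (fun i => (α i, 0)) (fun j => (0, β j))) (Sum.elim a b) ?_ ?_
  · rintro (i | j)
    · exact ha i
    · exact hb j
  · refine (h.prod_left h').congr_left fun t => ?_
    ext <;> simp [Prod.fst_sum, Prod.snd_sum]

theorem exists_isBigO_monomials {k : ℕ} (α : Fin k → E) (a : Fin k → ℝ) (ha : ∀ i, 0 < a i) :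
    ∃ c : ℝ, 0 < c ∧ (fun t : ℝ => ∑ i, t ^ (a i) • α i) =O[𝓝[>] 0] (fun t : ℝ => t ^ c) := by
  obtain ⟨c, hc, hca⟩ : ∃ c : ℝ, 0 < c ∧ ∀ i, c ≤ a i := by
    rcases isEmpty_or_nonempty (Fin k) with hk | hk
    · exact ⟨1, one_pos, fun i => hk.elim i⟩
    · obtain ⟨i, hi⟩ := Finite.exists_min a
      exact ⟨a i, ha i, hi⟩
  refine ⟨c, hc, IsBigO.fun_sum fun i _ => ?_⟩
  refine IsBigO.of_bound ‖α i‖ ?_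
  filter_upwards [Ioo_mem_nhdsGT (zero_lt_one (α := ℝ))] with t ht
  have h1 : t ^ (a i) ≤ t ^ c := Real.rpow_le_rpow_of_exponent_ge ht.1 ht.2.le (hca i)
  have h2 : 0 ≤ t ^ (a i) := Real.rpow_nonneg ht.1.le _
  have h3 : 0 ≤ t ^ c := Real.rpow_nonneg ht.1.le _
  rw [norm_smul, Real.norm_of_nonneg h2, Real.norm_of_nonneg h3, mul_comm]
  exact mul_le_mul_of_nonneg_left h1 (norm_nonneg _)

theorem tendsto_rpow_nhdsGT_zero {c : ℝ} (hc : 0 < c) :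
    Tendsto (fun t : ℝ => t ^ c) (𝓝[>] 0) (𝓝 0) := by
  have h := (Real.continuousAt_rpow_const 0 c (Or.inr hc.le)).tendsto
  rw [Real.zero_rpow hc.ne'] at h
  exact h.mono_left nhdsWithin_le_nhds

theorem tendsto_monomials {k : ℕ} (α : Fin k → E) (a : Fin k → ℝ) (ha : ∀ i, 0 < a i) :
    Tendsto (fun t : ℝ => ∑ i, t ^ (a i) • α i) (𝓝[>] 0) (𝓝 0) := by
  obtain ⟨c, hc, h⟩ := exists_isBigO_monomials α a ha
  exact h.trans_tendsto (tendsto_rpow_nhdsGT_zero hc)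

theorem IsLittleOhPoly.tendsto {x : ℝ → E} (hx : IsLittleOhPoly x) :
    Tendsto x (𝓝[>] 0) (𝓝 (x 0)) := by
  obtain ⟨k, α, a, ha, h⟩ := hx
  have h1 : Tendsto (fun t : ℝ => t) (𝓝[>] 0) (𝓝 0) := nhdsWithin_le_nhds
  have h2 := (h.isBigO.trans_tendsto h1).add (tendsto_monomials α a ha)
  have h3 := h2.add_const (x 0)
  simpa using h3

/-- Composition with a smooth map respects differences that are `o(t)`. -/
theorem isLittleO_comp_sub {f : E → F} {r : E} (hf : ContDiffAt ℝ ∞ f r) {x y : ℝ → E}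
    (hx : Tendsto x (𝓝[>] 0) (𝓝 r)) (hy : Tendsto y (𝓝[>] 0) (𝓝 r))
    (hxy : (fun t => x t - y t) =o[𝓝[>] 0] (fun t : ℝ => t)) :
    (fun t => f (x t) - f (y t)) =o[𝓝[>] 0] (fun t : ℝ => t) := by
  have h := (hf.hasStrictFDerivAt (by simp)).isBigO_sub
  exact (h.comp_tendsto (hx.prodMk_nhds hy)).trans_isLittleO hxy

/-- A smooth map sends little-oh polynomials to little-oh polynomials (Taylor's formula). -/
theorem IsLittleOhPoly.comp [CompleteSpace F] {x : ℝ → E} (hx : IsLittleOhPoly x) {f : E → F}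
    (hf : ContDiffAt ℝ ∞ f (x 0)) : IsLittleOhPoly (fun t => f (x t)) := by
  have hxt := hx.tendsto
  obtain ⟨k, α, a, ha, h⟩ := hx
  obtain ⟨c, hc, hO⟩ := exists_isBigO_monomials α a ha
  set P : ℝ → E := fun t => ∑ i, t ^ (a i) • α i with hP
  have hPt : Tendsto P (𝓝[>] 0) (𝓝 0) := tendsto_monomials α a ha
  have hyt : Tendsto (fun t => x 0 + P t) (𝓝[>] 0) (𝓝 (x 0)) := by
    simpa using hPt.const_add (x 0)
  have h1 : (fun t => f (x t) - f (x 0 + P t)) =o[𝓝[>] 0] (fun t : ℝ => t) :=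
    isLittleO_comp_sub hf hxt hyt (h.congr_left fun t => by abel)
  obtain ⟨n, hn⟩ := exists_nat_gt (1 / c)
  have hcn : 1 < c * ((n : ℝ) + 1) := by
    rw [div_lt_iff₀ hc] at hn
    nlinarith
  -- a ball on which `f` is smooth with bounded derivative of order `n + 1`
  have hfn : ContDiffAt ℝ ((n + 1 : ℕ) : WithTop ℕ∞) f (x 0) := hf.of_le (by exact_mod_cast le_top)
  have hev : ∀ᶠ z in 𝓝 (x 0), ContDiffAt ℝ ((n + 1 : ℕ) : WithTop ℕ∞) f z :=
    hfn.eventually (by simp)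
  have hcont : ContinuousAt (iteratedFDeriv ℝ (n + 1) f) (x 0) :=
    (hfn.iteratedFDeriv_right (i := n + 1) (m := 0) (by simp)).continuousAt
  have hbd : ∀ᶠ z in 𝓝 (x 0),
      ‖iteratedFDeriv ℝ (n + 1) f z‖ < ‖iteratedFDeriv ℝ (n + 1) f (x 0)‖ + 1 :=
    hcont.norm.eventually (gt_mem_nhds (lt_add_one _))
  set C : ℝ := ‖iteratedFDeriv ℝ (n + 1) f (x 0)‖ + 1 with hC
  obtain ⟨ρ, hρ, hball⟩ := Metric.eventually_nhds_iff_ball.1 (hev.and hbd)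
  set R : ℝ → F := fun t => (n.factorial : ℝ)⁻¹ • ∫ s in (0 : ℝ)..1,
    (1 - s) ^ n • iteratedFDeriv ℝ (n + 1) f (x 0 + s • P t) (fun _ => P t) with hR
  have hPball : ∀ᶠ t in 𝓝[>] (0 : ℝ), ‖P t‖ < ρ := by
    have := hPt.norm
    rw [norm_zero] at this
    exact this.eventually (gt_mem_nhds hρ)
  have hseg : ∀ t, ‖P t‖ < ρ → ∀ s ∈ Icc (0 : ℝ) 1, x 0 + s • P t ∈ Metric.ball (x 0) ρ := by
    intro t ht s hs
    rw [Metric.mem_ball, dist_eq_norm, add_sub_cancel_left, norm_smul, Real.norm_of_nonneg hs.1]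
    exact lt_of_le_of_lt (mul_le_of_le_one_left (norm_nonneg _) hs.2) ht
  have hTaylor : ∀ᶠ t in 𝓝[>] (0 : ℝ), f (x 0 + P t) = ∑ j ∈ Finset.range (n + 1),
      (j.factorial : ℝ)⁻¹ • (iteratedFDeriv ℝ j f (x 0) (fun _ => P t)) + R t := by
    filter_upwards [hPball] with t ht
    refine map_add_eq_sum_add_integral_iteratedFDeriv fun s hs => ?_
    exact_mod_cast (hball _ (hseg t ht s hs)).1
  have hRO : R =O[𝓝[>] 0] (fun t => ‖P t‖ ^ (n + 1)) := by
    refine IsBigO.of_bound (‖(n.factorial : ℝ)⁻¹‖ * C) ?_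
    filter_upwards [hPball] with t ht
    rw [hR]
    simp only [norm_smul]
    rw [mul_assoc]
    refine mul_le_mul_of_nonneg_left ?_ (norm_nonneg _)
    have := intervalIntegral.norm_integral_le_of_norm_le_const (a := (0 : ℝ)) (b := 1)
      (C := C * ‖P t‖ ^ (n + 1))
      (f := fun s => (1 - s) ^ n • iteratedFDeriv ℝ (n + 1) f (x 0 + s • P t) (fun _ => P t)) ?_
    · simpa using this
    · intro s hs
      rw [uIoc_of_le zero_le_one] at hs
      have hs' : s ∈ Icc (0 : ℝ) 1 := ⟨hs.1.le, hs.2⟩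
      rw [norm_smul]
      have e1 : ‖(1 - s) ^ n‖ ≤ 1 := by
        rw [norm_pow, Real.norm_of_nonneg (by linarith [hs.2])]
        exact pow_le_one₀ (by linarith [hs.2]) (by linarith [hs.1])
      have e2 : ‖iteratedFDeriv ℝ (n + 1) f (x 0 + s • P t) (fun _ => P t)‖
          ≤ C * ‖P t‖ ^ (n + 1) := by
        refine (ContinuousMultilinearMap.le_opNorm _ _).trans ?_
        rw [Finset.prod_const, Finset.card_univ, Fintype.card_fin]
        exact mul_le_mul_of_nonneg_right (hball _ (hseg t ht s hs')).2.le (by positivity)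
      calc _ ≤ 1 * (C * ‖P t‖ ^ (n + 1)) := mul_le_mul e1 e2 (norm_nonneg _) zero_le_one
        _ = _ := one_mul _
  have hRo : R =o[𝓝[>] 0] (fun t : ℝ => t) := by
    refine hRO.trans_isLittleO ((hO.norm_left.pow (n + 1)).trans_isLittleO ?_)
    have hd : 0 < c * ((n : ℝ) + 1) - 1 := by linarith
    refine isLittleO_of_tendsto' ?_ ?_
    · filter_upwards [self_mem_nhdsWithin] with t ht h0
      exact absurd h0 (ne_of_gt ht)
    · refine (tendsto_rpow_nhdsGT_zero hd).congr' ?_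
      filter_upwards [self_mem_nhdsWithin] with t ht
      have ht' : (0 : ℝ) < t := ht
      rw [Real.rpow_sub ht', Real.rpow_one, Real.rpow_mul ht'.le]
      congr 1
      exact_mod_cast Real.rpow_natCast (t ^ c) (n + 1)
  -- the Taylor polynomial, multiplied out
  refine IsLittleOhPoly.of_fintype (ι := Σ j : Fin n, (Fin (j.1 + 1) → Fin k))
    (fun p => ((p.1.1 + 1).factorial : ℝ)⁻¹ •
      iteratedFDeriv ℝ (p.1.1 + 1) f (x 0) (fun q => α (p.2 q)))
    (fun p => ∑ q, a (p.2 q)) (fun p => ?_) ?_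
  · exact Finset.sum_pos (fun q _ => ha _) Finset.univ_nonempty
  · refine (h1.add hRo).congr' ?_ EventuallyEq.rfl
    filter_upwards [hTaylor, self_mem_nhdsWithin] with t ht ht0
    have ht' : (0 : ℝ) < t := ht0
    rw [ht, Finset.sum_range_succ', Fintype.sum_sigma, Finset.sum_range]
    have key : ∀ j : Fin n, (((j : ℕ) + 1).factorial : ℝ)⁻¹ •
        (iteratedFDeriv ℝ ((j : ℕ) + 1) f (x 0) fun _ => P t) =
        ∑ r : Fin ((j : ℕ) + 1) → Fin k, t ^ (∑ q, a (r q)) •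
          ((((j : ℕ) + 1).factorial : ℝ)⁻¹ •
            iteratedFDeriv ℝ ((j : ℕ) + 1) f (x 0) (fun q => α (r q))) := by
      intro j
      rw [hP, ContinuousMultilinearMap.map_sum, Finset.smul_sum]
      refine Finset.sum_congr rfl fun r _ => ?_
      rw [ContinuousMultilinearMap.map_smul_univ, Real.rpow_sum_of_pos ht', smul_comm]
    rw [Finset.sum_congr rfl fun j _ => key j]
    simp only [Nat.factorial_zero, Nat.cast_one, inv_one, iteratedFDeriv_zero_apply, one_smul]
    abel

end LittleOh

/-- Little-oh polynomials as a type. -/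
def LittleOhPoly (E : Type*) [NormedAddCommGroup E] [NormedSpace ℝ E] : Type _ :=
  {x : ℝ → E // IsLittleOhPoly x}

/-- `x ∼ y` iff `x 0 = y 0` and `x t - y t = o(t)` as `t → 0⁺`. -/
instance littleOhSetoid (E : Type*) [NormedAddCommGroup E] [NormedSpace ℝ E] :
    Setoid (LittleOhPoly E) where
  r x y := x.1 0 = y.1 0 ∧ (fun t => x.1 t - y.1 t) =o[𝓝[>] 0] (fun t : ℝ => t)
  iseqv :=
    { refl := fun x => ⟨rfl, by simp⟩
      symm := fun h => ⟨h.1.symm, h.2.neg_left.congr_left fun t => by simp⟩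
      trans := fun h h' => ⟨h.1.trans h'.1, (h.2.add h'.2).congr_left fun t => by simp⟩ }

/-- The Fermat extension `•E` of a normed space `E`: little-oh polynomials modulo `∼`.
`Fermat ℝ` is the set of Fermat reals. -/
def Fermat (E : Type*) [NormedAddCommGroup E] [NormedSpace ℝ E] : Type _ :=
  Quotient (littleOhSetoid E)

namespace Fermat

section Basic

variable {E F : Type*} [NormedAddCommGroup E] [NormedSpace ℝ E]
  [NormedAddCommGroup F] [NormedSpace ℝ F]

/-- The class of a little-oh polynomial. -/
def mk (x : ℝ → E) (hx : IsLittleOhPoly x) : Fermat E :=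
  Quotient.mk (littleOhSetoid E) ⟨x, hx⟩

theorem mk_eq_mk {x y : ℝ → E} (hx : IsLittleOhPoly x) (hy : IsLittleOhPoly y) :
    mk x hx = mk y hy ↔ x 0 = y 0 ∧ (fun t => x t - y t) =o[𝓝[>] 0] (fun t : ℝ => t) :=
  Quotient.eq

/-- The standard part `°x`. -/
def std (x : Fermat E) : E :=
  Quotient.lift (s := littleOhSetoid E) (fun y : LittleOhPoly E => y.1 0)
    (fun a b (h : (littleOhSetoid E).r a b) => h.1) x

/-- For `U ⊆ E`, the subset `•U = {x | °x ∈ U}` of `•E`. -/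
def extSet (U : Set E) : Set (Fermat E) := {x | std x ∈ U}

instance : Zero (Fermat E) := ⟨mk (fun _ => 0) (isLittleOhPoly_const 0)⟩

/-- The infinitesimal part `δx = x - °x`. -/
def infPart (x : Fermat E) : Fermat E :=
  Quotient.map (sa := littleOhSetoid E) (sb := littleOhSetoid E)
    (fun y : LittleOhPoly E => (⟨fun t => y.1 t - y.1 0, y.2.sub_zero_val⟩ : LittleOhPoly E))
    (fun a b h => ⟨by simp, h.2.congr_left fun t => by
      show a.1 t - b.1 t = (a.1 t - a.1 0) - (b.1 t - b.1 0)
      rw [h.1]; abel⟩) x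

/-- The canonical bijection `•E × •F → •(E × F)`. -/
def pair (x : Fermat E) (y : Fermat F) : Fermat (E × F) :=
  Quotient.map₂ (sa := littleOhSetoid E) (sb := littleOhSetoid F) (sc := littleOhSetoid (E × F))
    (fun x y => (⟨fun t => (x.1 t, y.1 t), x.2.prodMk y.2⟩ : LittleOhPoly (E × F)))
    (fun _ _ h _ _ h' => ⟨Prod.ext h.1 h'.1, h.2.prod_left h'.2⟩) x y

theorem pair_mem {U : Set E} {V : Set F} {x : Fermat E} {y : Fermat F}
    (hx : x ∈ extSet U) (hy : y ∈ extSet V) : pair x y ∈ extSet (U ×ˢ V) := by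
  induction x using Quotient.inductionOn
  induction y using Quotient.inductionOn
  exact ⟨hx, hy⟩

theorem std_eq_out (x : Fermat E) : (Quotient.out x).1 0 = std x := by
  conv_rhs => rw [← Quotient.out_eq x]
  rfl

/-- The Fermat extension `•f : •U → •F`, `[x] ↦ [f ∘ x]`, of a smooth map `f` on an open set `U`.
It is computed with one representative; `fermatExt_mk` says that any representative will do. -/
def fermatExt [CompleteSpace F] (f : E → F) (U : Set E) (hU : IsOpen U)
    (hf : ContDiffOn ℝ ∞ f U) (x : extSet U) : Fermat F :=
  mk (fun t => f ((Quotient.out x.1).1 t)) ((Quotient.out x.1).2.comp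
    (hf.contDiffAt (hU.mem_nhds (by rw [std_eq_out]; exact x.2))))

theorem fermatExt_mk [CompleteSpace F] (f : E → F) (U : Set E) (hU : IsOpen U)
    (hf : ContDiffOn ℝ ∞ f U) (x : ℝ → E) (hx : IsLittleOhPoly x) (h0 : x 0 ∈ U) :
    fermatExt f U hU hf ⟨mk x hx, h0⟩ =
      mk (fun t => f (x t)) (hx.comp (hf.contDiffAt (hU.mem_nhds h0))) := by
  have h := Quotient.mk_out (s := littleOhSetoid E) (⟨x, hx⟩ : LittleOhPoly E)
  refine (mk_eq_mk _ _).2 ⟨congrArg f h.1, ?_⟩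
  refine isLittleO_comp_sub (hf.contDiffAt (hU.mem_nhds h0)) ?_ hx.tendsto h.2
  have h1 := (Quotient.out (mk x hx)).2.tendsto
  rwa [show (Quotient.out (mk x hx)).1 0 = x 0 from h.1] at h1

end Basic

/-- The element of `•ℝ` with quasi-decomposition `r + ∑ i, α i * t ^ (a i)`. -/
def ofCoeffs (r : ℝ) {n : ℕ} (α a : Fin n → ℝ) (ha : ∀ i, 0 < a i) : Fermat ℝ :=
  mk (fun t => r + ∑ i, t ^ (a i) • α i) (isLittleOhPoly_sum r α a ha)

/-- The order on `•ℝ`: write `x = °x + ∑ i, α i * t ^ (a i)` and `y = °y + ∑ i, β i * t ^ (a i)`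
with common exponents `0 < a 1 < ⋯ < a n ≤ 1`, and compare `(°x, α 1, …, α n)` with
`(°y, β 1, …, β n)` in the dictionary order. -/
instance : LE (Fermat ℝ) where
  le x y := ∃ (n : ℕ) (a α β : Fin n → ℝ) (ha : ∀ i, 0 < a i), StrictMono a ∧ (∀ i, a i ≤ 1) ∧
    x = ofCoeffs (std x) α a ha ∧ y = ofCoeffs (std y) β a ha ∧
    toLex (Fin.cons (std x) α : Fin (n + 1) → ℝ) ≤ toLex (Fin.cons (std y) β : Fin (n + 1) → ℝ)

instance : LT (Fermat ℝ) where
  lt x y := x ≤ y ∧ x ≠ y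

/-- The intermediate value property of `g : •U → •ℝ`: for `a < b` in `•U`, every `y` strictly
between `g a` and `g b` is `g c` for some `c` strictly between `a` and `b`.
(For `y ∈ {g a, g b}` there is nothing to prove.) -/
def HasIVP {U : Set ℝ} (g : extSet U → Fermat ℝ) : Prop :=
  ∀ a b : extSet U, a.1 < b.1 → ∀ y : Fermat ℝ,
    ((g a < y ∧ y < g b) ∨ (g b < y ∧ y < g a)) →
      ∃ c : extSet U, a.1 < c.1 ∧ c.1 < b.1 ∧ g c = y

end Fermat

/-- The mixed partial derivative `D^{(av, ax)} h` of a function `h (v, x)` of `v ∈ ℝ^d` and `x ∈ ℝ`,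
with multi-index `av` in the variables `v` and order `ax` in the variable `x`. -/
def mixedPartial {d : ℕ} (h : EuclideanSpace ℝ (Fin d) × ℝ → ℝ) (av : Fin d → ℕ) (ax : ℕ) :
    EuclideanSpace ℝ (Fin d) × ℝ → ℝ :=
  (List.finRange d).foldr
    (fun i F => (fun G p => lineDeriv ℝ G p (EuclideanSpace.single i (1 : ℝ), (0 : ℝ)))^[av i] F)
    ((fun G p => lineDeriv ℝ G p (0, (1 : ℝ)))^[ax] h)

end

/-!
Representatives turn the statement into one about germs at `0⁺` modulo `o(t)`. The dictionary order
on `•ℝ` becomes the relation `GermLT p q`: `p t + C t ≤ q t` near `0⁺` for some `C > 0`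
(`Fermat.mk_lt_mk`).

Fix `x₀` in `U` and let `m` be the order of the first nonvanishing derivative of `h (°v, ·)` at
`x₀`. By hypothesis the coefficients of `s ^ j`, `0 < j < m`, in the Taylor expansion of
`h (v, x₀ + s)` vanish to infinite order at `v = °v`, so they are `o(t)` along `v`
(`isBigO_pow_of_listPartial_eq_zero`). The terms of order at least `m` have the form
`σ s ^ m P (v, s)` with `σ = ±1` and `σ P > 0`, that is `σ ψ (v, s) ^ m` with
`ψ = s (σ P) ^ (1 / m)` an increasing smooth change of the variable `s` (`exists_normalForm`).
Truncating the Taylor expansion at a high order keeps `P` visibly smooth, and the discarded terms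
are `o(t)` along little-oh polynomials.

If `a` and `b` have the same standard part `x₀`, the equation `g c = y` thus reads
`σ w ^ m = y - h (v, x₀)` with `w = ψ (v, c - x₀)`. A positive infinitesimal has roots of every
order (`IsLittleOhPoly.exists_root`), and if `m` is even the position of `y` between `g a` and
`g b` forces the sign that makes the root exist, and selects the one between `ψ (v, a - x₀)` and `ψ (v, b - x₀)`
(`exists_root_between`). The inverse function theorem then returns `c`
(`exists_local_intermediate_value`).

If `°a < °b` and `g a < g b`, let `c₀` be the supremum of `°a` and of the points of `[°a, °b]` where
`h (°v, ·) < °y`. Since `h (°v, ·) - °y` behaves like a nonzero multiple of a power of `x - c₀`, it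
changes sign at `c₀` from negative to positive, apart from the sides lost at the endpoints, and for
small `ε` the points `c₀ ± t ^ ε` (or `a`, `b` themselves at the endpoints) already bracket `y`
(`exists_infinitesimal_bracket`). This reduces to the previous case. If `g b < g a`, the argument
applies to `-h`.
-/

/-! ### Iterated partial derivatives -/

section DirDeriv

variable {X : Type*} [NormedAddCommGroup X] [NormedSpace ℝ X]

/-- The derivative of `G` in the fixed direction `u`, as an operator on functions. -/
noncomputable def dirDeriv (u : X) (G : X → ℝ) : X → ℝ := fun p => lineDeriv ℝ G p u

theorem dirDeriv_eq_fderiv {W : Set X} (hW : IsOpen W) {G : X → ℝ} (hG : ContDiffOn ℝ ∞ G W)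
    (u : X) {p : X} (hp : p ∈ W) : dirDeriv u G p = fderiv ℝ G p u :=
  ((hG.contDiffAt (hW.mem_nhds hp)).differentiableAt (by simp)).lineDeriv_eq_fderiv

theorem ContDiffOn.dirDeriv {W : Set X} (hW : IsOpen W) {G : X → ℝ} (hG : ContDiffOn ℝ ∞ G W)
    (u : X) : ContDiffOn ℝ ∞ (dirDeriv u G) W :=
  ((hG.fderiv_of_isOpen hW (m := ∞) (by simp)).clm_apply contDiffOn_const).congr
    fun _ hp => dirDeriv_eq_fderiv hW hG u hp

theorem ContDiffOn.iterate_dirDeriv {W : Set X} (hW : IsOpen W) {G : X → ℝ}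
    (hG : ContDiffOn ℝ ∞ G W) (u : X) (n : ℕ) : ContDiffOn ℝ ∞ ((_root_.dirDeriv u)^[n] G) W := by
  induction n with
  | zero => exact hG
  | succ n ih =>
    rw [Function.iterate_succ_apply']
    exact ih.dirDeriv hW u

theorem dirDeriv_congr {W : Set X} (hW : IsOpen W) {G H : X → ℝ} (h : EqOn G H W) (u : X) :
    EqOn (dirDeriv u G) (dirDeriv u H) W := fun p hp => by
  have : G =ᶠ[𝓝 p] H := eventuallyEq_of_mem (hW.mem_nhds hp) h
  exact this.lineDeriv_eq

theorem iterate_dirDeriv_congr {W : Set X} (hW : IsOpen W) {G H : X → ℝ} (h : EqOn G H W) (u : X)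
    (n : ℕ) : EqOn ((dirDeriv u)^[n] G) ((dirDeriv u)^[n] H) W := by
  induction n with
  | zero => exact h
  | succ n ih =>
    simp only [Function.iterate_succ_apply']
    exact dirDeriv_congr hW ih u

theorem dirDeriv_neg (u : X) (G : X → ℝ) : dirDeriv u (-G) = -dirDeriv u G := by
  funext p
  simp [dirDeriv, lineDeriv, deriv.fun_neg]

theorem iterate_dirDeriv_neg (u : X) (G : X → ℝ) (n : ℕ) :
    (dirDeriv u)^[n] (-G) = -(dirDeriv u)^[n] G := by
  induction n with
  | zero => rfl
  | succ n ih => rw [Function.iterate_succ_apply', ih, dirDeriv_neg, Function.iterate_succ_apply']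

theorem dirDeriv_comm {W : Set X} (hW : IsOpen W) {G : X → ℝ} (hG : ContDiffOn ℝ ∞ G W)
    (u w : X) : EqOn (dirDeriv u (dirDeriv w G)) (dirDeriv w (dirDeriv u G)) W := by
  intro p hp
  have hGp := hG.contDiffAt (hW.mem_nhds hp)
  have htwo : (2 : WithTop ℕ∞) ≤ ∞ := WithTop.coe_le_coe.2 le_top
  have hd : DifferentiableAt ℝ (fderiv ℝ G) p :=
    (hGp.fderiv_right (m := 1) (by rwa [one_add_one_eq_two])).differentiableAt (by simp)
  have key : ∀ a b : X, dirDeriv a (dirDeriv b G) p = fderiv ℝ (fderiv ℝ G) p a b := by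
    intro a b
    rw [dirDeriv_congr hW (fun q hq => dirDeriv_eq_fderiv hW hG b hq) a hp]
    have h2 : HasFDerivAt (fun q => fderiv ℝ G q b)
        ((ContinuousLinearMap.apply ℝ ℝ b).comp (fderiv ℝ (fderiv ℝ G) p)) p :=
      (ContinuousLinearMap.apply ℝ ℝ b).hasFDerivAt.comp p hd.hasFDerivAt
    rw [dirDeriv, (h2.differentiableAt).lineDeriv_eq_fderiv, h2.fderiv]
    rfl
  rw [key, key]
  exact (hGp.isSymmSndFDerivAt (by simpa using htwo)).eq u w

theorem dirDeriv_iterate_comm {W : Set X} (hW : IsOpen W) {G : X → ℝ} (hG : ContDiffOn ℝ ∞ G W)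
    (u w : X) (n : ℕ) :
    EqOn (dirDeriv u ((dirDeriv w)^[n] G)) ((dirDeriv w)^[n] (dirDeriv u G)) W := by
  induction n with
  | zero => exact fun _ _ => rfl
  | succ n ih =>
    simp only [Function.iterate_succ_apply']
    rw [← Function.iterate_succ_apply' (dirDeriv w) n G]
    simp only [Function.iterate_succ_apply']
    exact (dirDeriv_comm hW (hG.iterate_dirDeriv hW w n) u w).trans (dirDeriv_congr hW ih w)

variable {ι : Type*}

/-- The iterated derivative with multiplicity `av i` in the direction `e i`, for `i` in the
list `l`. -/
noncomputable def listPartial (e : ι → X) (l : List ι) (av : ι → ℕ) (G : X → ℝ) : X → ℝ :=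
  l.foldr (fun i F => (dirDeriv (e i))^[av i] F) G

theorem listPartial_cons (e : ι → X) (i : ι) (l : List ι) (av : ι → ℕ) (G : X → ℝ) :
    listPartial e (i :: l) av G = (dirDeriv (e i))^[av i] (listPartial e l av G) := rfl

theorem ContDiffOn.listPartial {W : Set X} (hW : IsOpen W) {G : X → ℝ} (hG : ContDiffOn ℝ ∞ G W)
    (e : ι → X) (l : List ι) (av : ι → ℕ) : ContDiffOn ℝ ∞ (listPartial e l av G) W := by
  induction l with
  | nil => exact hG
  | cons i l ih => exact ih.iterate_dirDeriv hW _ _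

theorem dirDeriv_listPartial {W : Set X} (hW : IsOpen W) {G : X → ℝ} (hG : ContDiffOn ℝ ∞ G W)
    (e : ι → X) (l : List ι) (av : ι → ℕ) (u : X) :
    EqOn (dirDeriv u (listPartial e l av G)) (listPartial e l av (dirDeriv u G)) W := by
  induction l with
  | nil => exact fun _ _ => rfl
  | cons i l ih =>
    simp only [listPartial_cons]
    exact (dirDeriv_iterate_comm hW (hG.listPartial hW e l av) _ _ _).trans
      (iterate_dirDeriv_congr hW ih _ _)

theorem listPartial_congr_index (e : ι → X) {l : List ι} {av bv : ι → ℕ}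
    (h : ∀ i ∈ l, av i = bv i) (G : X → ℝ) : listPartial e l av G = listPartial e l bv G := by
  induction l with
  | nil => rfl
  | cons i l ih =>
    rw [listPartial_cons, listPartial_cons, h i (by simp),
      ih fun j hj => h j (List.mem_cons_of_mem _ hj)]

theorem dirDeriv_listPartial_eq_update [DecidableEq ι] {W : Set X} (hW : IsOpen W) {G : X → ℝ}
    (hG : ContDiffOn ℝ ∞ G W) (e : ι → X) {l : List ι} (hl : l.Nodup) (av : ι → ℕ) {i : ι}
    (hi : i ∈ l) :
    EqOn (dirDeriv (e i) (listPartial e l av G))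
      (listPartial e l (Function.update av i (av i + 1)) G) W := by
  induction l with
  | nil => simp at hi
  | cons k l ih =>
    rw [List.nodup_cons] at hl
    simp only [listPartial_cons]
    by_cases hk : k = i
    · subst hk
      rw [Function.update_self, Function.iterate_succ_apply',
        listPartial_congr_index e (av := av) (bv := Function.update av k (av k + 1)) (l := l)]
      · exact fun _ _ => rfl
      · intro j hj
        rw [Function.update_of_ne]
        rintro rfl
        exact hl.1 hj
    · rw [Function.update_of_ne hk]
      exact (dirDeriv_iterate_comm hW (hG.listPartial hW e l av) _ _ _).trans
        (iterate_dirDeriv_congr hW (ih hl.2 (by simpa [Ne.symm hk] using hi)) _ _)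

/-- The vanishing of all partial derivatives at a point passes to each partial derivative, as
partial derivatives commute. -/
theorem listPartial_dirDeriv_eq_zero [DecidableEq ι] {W : Set X} (hW : IsOpen W) {G : X → ℝ}
    (hG : ContDiffOn ℝ ∞ G W) (e : ι → X) {l : List ι} (hl : l.Nodup) {p : X} (hp : p ∈ W)
    (h : ∀ av, listPartial e l av G p = 0) {i : ι} (hi : i ∈ l) (av : ι → ℕ) :
    listPartial e l av (dirDeriv (e i) G) p = 0 := by
  rw [← dirDeriv_listPartial hW hG e l av (e i) hp,
    dirDeriv_listPartial_eq_update hW hG e hl av hi hp, h]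

end DirDeriv

theorem mixedPartial_eq_listPartial {d : ℕ} (h : EuclideanSpace ℝ (Fin d) × ℝ → ℝ)
    (av : Fin d → ℕ) (ax : ℕ) :
    mixedPartial h av ax = listPartial (fun i => (EuclideanSpace.single i (1 : ℝ), (0 : ℝ)))
      (List.finRange d) av ((dirDeriv (0, (1 : ℝ)))^[ax] h) := rfl

theorem mixedPartial_zero {d : ℕ} (h : EuclideanSpace ℝ (Fin d) × ℝ → ℝ) (ax : ℕ) :
    mixedPartial h 0 ax = (dirDeriv (0, (1 : ℝ)))^[ax] h := by
  rw [mixedPartial_eq_listPartial]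
  induction List.finRange d with
  | nil => rfl
  | cons i l ih => rw [listPartial_cons, ih]; rfl

theorem EuclideanSpace.opNorm_le_sum {d : ℕ} (L : EuclideanSpace ℝ (Fin d) →L[ℝ] ℝ) :
    ‖L‖ ≤ ∑ i, ‖L (EuclideanSpace.single i 1)‖ := by
  refine L.opNorm_le_bound (by positivity) fun u => ?_
  have hu : u = ∑ i, u i • EuclideanSpace.single i (1 : ℝ) := by
    ext j
    simp [Finset.sum_apply, Pi.single_apply]
  calc ‖L u‖ = ‖∑ i, u i • L (EuclideanSpace.single i 1)‖ := by
        conv_lhs => rw [hu]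
        rw [map_sum]; simp only [map_smul]
    _ ≤ ∑ i, ‖u i • L (EuclideanSpace.single i 1)‖ := norm_sum_le _ _
    _ ≤ ∑ i, ‖L (EuclideanSpace.single i 1)‖ * ‖u‖ := by
        refine Finset.sum_le_sum fun i _ => ?_
        rw [norm_smul, mul_comm]
        exact mul_le_mul_of_nonneg_left (PiLp.norm_apply_le u i) (norm_nonneg _)
    _ = _ := (Finset.sum_mul _ _ _).symm

/-- A smooth function all of whose partial derivatives in the variable `v` vanish at a point
vanishes there to infinite order in `v`. The induction bounds the gradient and integrates. -/
theorem isBigO_pow_of_listPartial_eq_zero {d : ℕ} {W : Set (EuclideanSpace ℝ (Fin d) × ℝ)}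
    (hW : IsOpen W) {v₀ : EuclideanSpace ℝ (Fin d)} {x₀ : ℝ} (hp : (v₀, x₀) ∈ W) (n : ℕ)
    {G : EuclideanSpace ℝ (Fin d) × ℝ → ℝ} (hG : ContDiffOn ℝ ∞ G W)
    (h : ∀ av, listPartial (fun i => (EuclideanSpace.single i (1 : ℝ), (0 : ℝ)))
      (List.finRange d) av G (v₀, x₀) = 0) :
    (fun v => G (v, x₀)) =O[𝓝 v₀] fun v => ‖v - v₀‖ ^ n := by
  classical
  have hmk : Continuous fun v : EuclideanSpace ℝ (Fin d) => (v, x₀) := by fun_prop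
  induction n generalizing G with
  | zero =>
    simp only [pow_zero]
    have hc : ContinuousAt (fun v => G (v, x₀)) v₀ :=
      (hG.contDiffAt (hW.mem_nhds hp)).continuousAt.comp_of_eq hmk.continuousAt rfl
    exact hc.isBigO_one ℝ
  | succ n ih =>
    have hder : ∀ᶠ v in 𝓝 v₀, (v, x₀) ∈ W := hmk.continuousAt.eventually (hW.mem_nhds hp)
    have hsum : (fun v => ∑ i, ‖dirDeriv (EuclideanSpace.single i (1 : ℝ), (0 : ℝ)) G (v, x₀)‖)
        =O[𝓝 v₀] fun v => ‖v - v₀‖ ^ n :=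
      IsBigO.fun_sum fun i _ => (ih (hG.dirDeriv hW _) fun av =>
        listPartial_dirDeriv_eq_zero hW hG
          (fun i => (EuclideanSpace.single i (1 : ℝ), (0 : ℝ))) (List.nodup_finRange d) hp h
          (List.mem_finRange i) av).norm_left
    obtain ⟨C, hC0, hC⟩ := hsum.exists_pos
    obtain ⟨ρ, hρ, hball⟩ := Metric.eventually_nhds_iff_ball.1 (hder.and hC.bound)
    have hG0 : G (v₀, x₀) = 0 := by
      have := h 0
      rwa [← Function.iterate_zero_apply (dirDeriv (0, (1 : ℝ))) G,
        ← mixedPartial_eq_listPartial G 0 0, mixedPartial_zero] at this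
    refine IsBigO.of_bound C ?_
    filter_upwards [Metric.ball_mem_nhds v₀ hρ] with v hv
    have hfd : ∀ w ∈ Metric.ball v₀ ρ, HasFDerivAt (fun w => G (w, x₀))
        ((fderiv ℝ G (w, x₀)).comp (ContinuousLinearMap.inl ℝ _ ℝ)) w := by
      intro w hw
      have h1 : HasFDerivAt G (fderiv ℝ G (w, x₀)) (w, x₀) :=
        ((hG.contDiffAt (hW.mem_nhds (hball w hw).1)).differentiableAt (by simp)).hasFDerivAt
      exact h1.comp w (hasFDerivAt_prodMk_left w x₀)
    have hsub : Metric.closedBall v₀ ‖v - v₀‖ ⊆ Metric.ball v₀ ρ :=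
      Metric.closedBall_subset_ball (by simpa [dist_eq_norm] using hv)
    have hmv := (convex_closedBall v₀ ‖v - v₀‖).norm_image_sub_le_of_norm_hasFDerivWithin_le
      (f := fun w => G (w, x₀))
      (f' := fun w => (fderiv ℝ G (w, x₀)).comp (ContinuousLinearMap.inl ℝ _ ℝ))
      (C := C * ‖v - v₀‖ ^ n) (x := v₀) (y := v)
      (fun w hw => (hfd w (hsub hw)).hasFDerivWithinAt) ?_
      (by simp) (by simp [dist_eq_norm])
    · simpa [hG0, pow_succ, mul_assoc] using hmv
    · intro w hw
      have hwv : ‖w - v₀‖ ≤ ‖v - v₀‖ := by simpa [dist_eq_norm] using hw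
      have hw2 := (hball w (hsub hw)).2
      rw [Real.norm_of_nonneg (by positivity), Real.norm_of_nonneg (by positivity)] at hw2
      refine (EuclideanSpace.opNorm_le_sum _).trans (le_trans (le_of_eq ?_) (hw2.trans ?_))
      · refine Finset.sum_congr rfl fun i _ => ?_
        rw [dirDeriv_eq_fderiv hW hG _ (hball w (hsub hw)).1]
        rfl
      · gcongr

section Taylor

variable {E : Type*} [NormedAddCommGroup E] [NormedSpace ℝ E]

/-- The remainder at `(v, x₀ + s)`, as a function of `(v, s)`, of the Taylor polynomial of
`h (v, ·)` at `x₀` with `n` terms. -/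
noncomputable def taylorRem (h : E × ℝ → ℝ) (x₀ : ℝ) (n : ℕ) (p : E × ℝ) : ℝ :=
  h (p.1, x₀ + p.2) -
    ∑ j ∈ Finset.range n, (dirDeriv (0, (1 : ℝ)))^[j] h (p.1, x₀) * p.2 ^ j / j.factorial

theorem taylorRem_succ_zero (h : E × ℝ → ℝ) (x₀ : ℝ) (n : ℕ) (v : E) :
    taylorRem h x₀ (n + 1) (v, 0) = 0 := by
  simp [taylorRem, Finset.sum_range_succ']

theorem hasDerivAt_add_snd {W : Set (E × ℝ)} (hW : IsOpen W) {h : E × ℝ → ℝ}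
    (hh : ContDiffOn ℝ ∞ h W) {v : E} {x₀ s : ℝ} (hp : (v, x₀ + s) ∈ W) :
    HasDerivAt (fun s => h (v, x₀ + s)) (dirDeriv (0, (1 : ℝ)) h (v, x₀ + s)) s := by
  rw [dirDeriv_eq_fderiv hW hh _ hp]
  have h1 : HasFDerivAt h (fderiv ℝ h (v, x₀ + s)) (v, x₀ + s) :=
    ((hh.contDiffAt (hW.mem_nhds hp)).differentiableAt (by simp)).hasFDerivAt
  have h2 : HasDerivAt (fun s : ℝ => (v, x₀ + s)) ((0 : E), (1 : ℝ)) s :=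
    (hasDerivAt_const s v).prodMk ((hasDerivAt_id s).const_add x₀)
  exact h1.comp_hasDerivAt s h2

theorem hasDerivAt_taylorRem {W : Set (E × ℝ)} (hW : IsOpen W) {h : E × ℝ → ℝ}
    (hh : ContDiffOn ℝ ∞ h W) {v : E} {x₀ s : ℝ} (hp : (v, x₀ + s) ∈ W) (n : ℕ) :
    HasDerivAt (fun s => taylorRem h x₀ (n + 1) (v, s))
      (taylorRem (dirDeriv (0, (1 : ℝ)) h) x₀ n (v, s)) s := by
  refine (hasDerivAt_add_snd hW hh hp).sub ?_
  simp only [Finset.sum_range_succ']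
  have : HasDerivAt (fun s : ℝ => ∑ j ∈ Finset.range n,
      (dirDeriv (0, (1 : ℝ)))^[j + 1] h (v, x₀) * s ^ (j + 1) / ((j + 1).factorial : ℝ))
      (∑ j ∈ Finset.range n, (dirDeriv (0, (1 : ℝ)))^[j] (dirDeriv (0, (1 : ℝ)) h) (v, x₀) *
        s ^ j / (j.factorial : ℝ)) s := by
    refine HasDerivAt.fun_sum fun j _ => ?_
    refine (((hasDerivAt_pow (j + 1) s).const_mul _).div_const _).congr_deriv ?_
    rw [Function.iterate_succ_apply, Nat.factorial_succ]
    have : (j.factorial : ℝ) ≠ 0 := by positivity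
    push_cast
    field_simp
  simpa [-Function.iterate_succ] using this

/-- Taylor's formula in one variable, uniformly in the parameter `v`. -/
theorem taylorRem_isBigO {W : Set (E × ℝ)} (hW : IsOpen W) {v₀ : E} {x₀ : ℝ}
    (hp : (v₀, x₀) ∈ W) (n : ℕ) {h : E × ℝ → ℝ} (hh : ContDiffOn ℝ ∞ h W) :
    taylorRem h x₀ n =O[𝓝 (v₀, 0)] fun p => ‖p.2‖ ^ n := by
  have hmk : ContinuousAt (fun p : E × ℝ => (p.1, x₀ + p.2)) (v₀, 0) := by fun_prop
  have hW' : W ∈ 𝓝 ((v₀, (0 : ℝ)).1, x₀ + (v₀, (0 : ℝ)).2) := hW.mem_nhds (by simpa using hp)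
  induction n generalizing h with
  | zero =>
    simp only [pow_zero]
    have hc : ContinuousAt (fun p : E × ℝ => h (p.1, x₀ + p.2)) (v₀, 0) :=
      ContinuousAt.comp (f := fun p : E × ℝ => (p.1, x₀ + p.2))
        (hh.contDiffAt hW').continuousAt hmk
    exact (hc.isBigO_one ℝ).congr_left fun p => by simp [taylorRem]
  | succ n ih =>
    obtain ⟨C, hC0, hC⟩ := (ih (hh.dirDeriv hW (0, (1 : ℝ)))).exists_pos
    obtain ⟨ρ, hρ, hball⟩ := Metric.eventually_nhds_iff_ball.1
      ((hmk.eventually hW').and hC.bound)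
    refine IsBigO.of_bound C ?_
    filter_upwards [Metric.ball_mem_nhds (v₀, (0 : ℝ)) hρ]
    rintro ⟨v, s⟩ hvs
    have hsub : ∀ θ ∈ Metric.closedBall (0 : ℝ) ‖s‖, (v, θ) ∈ Metric.ball (v₀, (0 : ℝ)) ρ := by
      intro θ hθ
      rw [Metric.mem_ball, Prod.dist_eq, max_lt_iff] at hvs ⊢
      refine ⟨hvs.1, lt_of_le_of_lt ?_ hvs.2⟩
      simpa [dist_eq_norm] using hθ
    have hmv := (convex_closedBall (0 : ℝ) ‖s‖).norm_image_sub_le_of_norm_hasDerivWithin_le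
      (f := fun θ => taylorRem h x₀ (n + 1) (v, θ))
      (f' := fun θ => taylorRem (dirDeriv (0, (1 : ℝ)) h) x₀ n (v, θ))
      (C := C * ‖s‖ ^ n) (x := 0) (y := s)
      (fun θ hθ => (hasDerivAt_taylorRem hW hh (hball _ (hsub θ hθ)).1 n).hasDerivWithinAt) ?_
      (by simp) (by simp)
    · rw [taylorRem_succ_zero] at hmv
      simpa [pow_succ, mul_assoc] using hmv
    · intro θ hθ
      refine (hball _ (hsub θ hθ)).2.trans ?_
      have hθ' : ‖θ‖ ≤ ‖s‖ := by simpa using hθ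
      rw [norm_pow, norm_norm]
      gcongr

end Taylor

/-! ### Asymptotics of little-oh polynomials -/

theorem rpow_isBigO_rpow {a b : ℝ} (hab : a ≤ b) :
    (fun t : ℝ => t ^ b) =O[𝓝[>] 0] fun t : ℝ => t ^ a := by
  refine IsBigO.of_bound 1 ?_
  filter_upwards [Ioo_mem_nhdsGT (zero_lt_one (α := ℝ))] with t ht
  rw [one_mul, Real.norm_of_nonneg (Real.rpow_nonneg ht.1.le _),
    Real.norm_of_nonneg (Real.rpow_nonneg ht.1.le _)]
  exact Real.rpow_le_rpow_of_exponent_ge ht.1 ht.2.le hab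

theorem rpow_isLittleO_rpow {a b : ℝ} (hab : a < b) :
    (fun t : ℝ => t ^ b) =o[𝓝[>] 0] fun t : ℝ => t ^ a := by
  refine isLittleO_of_tendsto' ?_ ?_
  · filter_upwards [self_mem_nhdsWithin] with t ht h0
    exact absurd h0 (Real.rpow_pos_of_pos ht _).ne'
  · refine (tendsto_rpow_nhdsGT_zero (sub_pos.2 hab)).congr' ?_
    filter_upwards [self_mem_nhdsWithin] with t ht
    exact Real.rpow_sub ht _ _

theorem rpow_isLittleO_self {b : ℝ} (hb : 1 < b) :
    (fun t : ℝ => t ^ b) =o[𝓝[>] 0] fun t : ℝ => t := by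
  simpa using rpow_isLittleO_rpow hb

section Normed

variable {E : Type*} [NormedAddCommGroup E] [NormedSpace ℝ E]

theorem IsLittleOhPoly.exists_isBigO {x : ℝ → E} (hx : IsLittleOhPoly x) :
    ∃ e : ℝ, 0 < e ∧ (fun t => x t - x 0) =O[𝓝[>] 0] fun t : ℝ => t ^ e := by
  obtain ⟨k, α, a, ha, h⟩ := hx
  obtain ⟨c, hc, hO⟩ := exists_isBigO_monomials α a ha
  refine ⟨min c 1, lt_min hc one_pos, ?_⟩
  have h1 : (fun t : ℝ => t) =O[𝓝[>] 0] fun t : ℝ => t ^ (min c 1) := by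
    simpa using rpow_isBigO_rpow (min_le_right c 1)
  have h2 := (h.isBigO.trans h1).add (hO.trans (rpow_isBigO_rpow (min_le_left c 1)))
  simpa using h2

theorem IsLittleOhPoly.eventually_pow_isLittleO {x : ℝ → E} (hx : IsLittleOhPoly x) :
    ∀ᶠ n : ℕ in atTop, (fun t => ‖x t - x 0‖ ^ n) =o[𝓝[>] 0] fun t : ℝ => t := by
  obtain ⟨e, he, hO⟩ := hx.exists_isBigO
  filter_upwards [(tendsto_natCast_atTop_atTop (R := ℝ)).eventually_gt_atTop (1 / e)] with n hn
  rw [div_lt_iff₀ he] at hn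
  refine (hO.norm_left.pow n).trans_isLittleO
    ((rpow_isLittleO_self (b := e * n) (by linarith)).congr' ?_ EventuallyEq.rfl)
  filter_upwards [self_mem_nhdsWithin] with t ht
  exact Real.rpow_mul_natCast (le_of_lt ht) _ _

theorem IsLittleOhPoly.eventually_isLittleO_rpow {x : ℝ → E} (hx : IsLittleOhPoly x) :
    ∀ᶠ ε in 𝓝[>] (0 : ℝ), (fun t => x t - x 0) =o[𝓝[>] 0] fun t : ℝ => t ^ ε := by
  obtain ⟨e, he, hO⟩ := hx.exists_isBigO
  filter_upwards [Ioo_mem_nhdsGT he] with ε hε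
  exact hO.trans_isLittleO (rpow_isLittleO_rpow hε.2)

end Normed

theorem IsLittleOhPoly.add {x y : ℝ → ℝ} (hx : IsLittleOhPoly x) (hy : IsLittleOhPoly y) :
    IsLittleOhPoly fun t => x t + y t :=
  (hx.prodMk hy).comp (f := fun p : ℝ × ℝ => p.1 + p.2) (by fun_prop)

theorem IsLittleOhPoly.sub {x y : ℝ → ℝ} (hx : IsLittleOhPoly x) (hy : IsLittleOhPoly y) :
    IsLittleOhPoly fun t => x t - y t :=
  (hx.prodMk hy).comp (f := fun p : ℝ × ℝ => p.1 - p.2) (by fun_prop)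

theorem IsLittleOhPoly.mul {x y : ℝ → ℝ} (hx : IsLittleOhPoly x) (hy : IsLittleOhPoly y) :
    IsLittleOhPoly fun t => x t * y t :=
  (hx.prodMk hy).comp (f := fun p : ℝ × ℝ => p.1 * p.2) (by fun_prop)

theorem IsLittleOhPoly.neg {x : ℝ → ℝ} (hx : IsLittleOhPoly x) :
    IsLittleOhPoly fun t => -x t :=
  hx.comp (f := fun p : ℝ => -p) (by fun_prop)

theorem isLittleOhPoly_rpow {a : ℝ} (ha : 0 < a) : IsLittleOhPoly fun t : ℝ => t ^ a := by
  simpa using isLittleOhPoly_sum (0 : ℝ) (k := 1) (fun _ => 1) (fun _ => a) fun _ => ha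

/-! ### The order on germs modulo `o(t)` -/

/-- `p` lies below `q` near `0⁺` by a margin that is not `o(t)`. -/
def GermLT (p q : ℝ → ℝ) : Prop := ∃ C > 0, ∀ᶠ t in 𝓝[>] (0 : ℝ), p t + C * t ≤ q t

theorem isLittleO_iff_abs_le {z : ℝ → ℝ} :
    z =o[𝓝[>] 0] (fun t : ℝ => t) ↔ ∀ C > 0, ∀ᶠ t in 𝓝[>] (0 : ℝ), |z t| ≤ C * t := by
  rw [isLittleO_iff]
  refine forall₂_congr fun C _ => eventually_congr ?_
  filter_upwards [self_mem_nhdsWithin] with t ht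
  rw [Real.norm_eq_abs, Real.norm_eq_abs, abs_of_pos (show (0 : ℝ) < t from ht)]

theorem GermLT.congr {p q p' q' : ℝ → ℝ} (h : GermLT p q)
    (hp : (fun t => p' t - p t) =o[𝓝[>] 0] fun t : ℝ => t)
    (hq : (fun t => q' t - q t) =o[𝓝[>] 0] fun t : ℝ => t) : GermLT p' q' := by
  obtain ⟨C, hC, h⟩ := h
  refine ⟨C / 2, half_pos hC, ?_⟩
  filter_upwards [h, isLittleO_iff_abs_le.1 hp (C / 4) (by positivity),
    isLittleO_iff_abs_le.1 hq (C / 4) (by positivity)] with t h1 h2 h3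
  rw [abs_le] at h2 h3
  linarith

theorem GermLT.eventually_lt {p q : ℝ → ℝ} (h : GermLT p q) : ∀ᶠ t in 𝓝[>] (0 : ℝ), p t < q t := by
  obtain ⟨C, hC, h⟩ := h
  filter_upwards [h, self_mem_nhdsWithin] with t h1 ht
  have : 0 < C * t := mul_pos hC ht
  linarith

theorem GermLT.asymm {p q : ℝ → ℝ} (h : GermLT p q) : ¬ GermLT q p := fun h' => by
  obtain ⟨t, h1, h2⟩ := (h.eventually_lt.and h'.eventually_lt).exists
  exact lt_asymm h1 h2

theorem GermLT.trans_le {p q r : ℝ → ℝ} (h : GermLT p q) (h' : ∀ᶠ t in 𝓝[>] (0 : ℝ), q t ≤ r t) :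
    GermLT p r := by
  obtain ⟨C, hC, h⟩ := h
  exact ⟨C, hC, by filter_upwards [h, h'] with t h1 h2 using h1.trans h2⟩

theorem GermLT.le_trans {p q r : ℝ → ℝ} (h : ∀ᶠ t in 𝓝[>] (0 : ℝ), p t ≤ q t) (h' : GermLT q r) :
    GermLT p r := by
  obtain ⟨C, hC, h'⟩ := h'
  exact ⟨C, hC, by filter_upwards [h, h'] with t h1 h2 using by linarith⟩

theorem GermLT.not_isLittleO {p q : ℝ → ℝ} (h : GermLT p q) :
    ¬ (fun t => p t - q t) =o[𝓝[>] 0] fun t : ℝ => t := fun h0 =>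
  (h.congr (p' := q) (q' := p) (by simpa using h0.neg_left) h0).asymm h

theorem GermLT.neg {p q : ℝ → ℝ} (h : GermLT p q) : GermLT (fun t => -q t) (fun t => -p t) := by
  obtain ⟨C, hC, h⟩ := h
  exact ⟨C, hC, by filter_upwards [h] with t h1; linarith⟩

theorem germLT_of_lt {p q : ℝ → ℝ} {a b : ℝ} (hp : Tendsto p (𝓝[>] 0) (𝓝 a))
    (hq : Tendsto q (𝓝[>] 0) (𝓝 b)) (h : a < b) : GermLT p q := by
  refine ⟨1, one_pos, ?_⟩
  have h1 : Tendsto (fun t : ℝ => p t + 1 * t) (𝓝[>] 0) (𝓝 (a + 1 * 0)) :=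
    hp.add (tendsto_const_nhds.mul nhdsWithin_le_nhds)
  exact (h1.eventually_lt hq (by simpa using h)).mono fun _ => le_of_lt

theorem GermLT.le_of_tendsto {p q : ℝ → ℝ} {a b : ℝ} (h : GermLT p q)
    (hp : Tendsto p (𝓝[>] 0) (𝓝 a)) (hq : Tendsto q (𝓝[>] 0) (𝓝 b)) : a ≤ b :=
  _root_.le_of_tendsto_of_tendsto hp hq (h.eventually_lt.mono fun _ => le_of_lt)

/-! ### Leading terms -/

/-- The monomials of a little-oh polynomial may be taken from any finite set that contains all its
exponents up to `1`: equal exponents are collected, exponents above `1` dropped. -/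
theorem exists_coeffs_orderEmb {k : ℕ} (α a : Fin k → ℝ) (S : Finset ℝ) (hS : ∀ s ∈ S, s ≤ 1)
    (haS : ∀ i, a i ≤ 1 → a i ∈ S) :
    ∃ γ : Fin S.card → ℝ, (fun t : ℝ => ∑ i, t ^ (a i) • α i -
      ∑ j, t ^ (S.orderEmbOfFin rfl j) • γ j) =o[𝓝[>] 0] fun t : ℝ => t := by
  refine ⟨fun j => ∑ i, if a i = S.orderEmbOfFin rfl j then α i else 0, ?_⟩
  have hswap : ∀ t : ℝ, ∑ j, t ^ (S.orderEmbOfFin rfl j) •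
      (∑ i, if a i = S.orderEmbOfFin rfl j then α i else 0) =
      ∑ i, ∑ j, t ^ (S.orderEmbOfFin rfl j) • (if a i = S.orderEmbOfFin rfl j then α i else 0) := by
    intro t
    simp only [Finset.smul_sum]
    exact Finset.sum_comm
  simp only [hswap, ← Finset.sum_sub_distrib]
  refine IsLittleO.fun_sum fun i _ => ?_
  by_cases hi : a i ≤ 1
  · have : a i ∈ Set.range (S.orderEmbOfFin rfl) := by
      rw [Finset.range_orderEmbOfFin]
      exact haS i hi
    obtain ⟨j, hj⟩ := this
    refine (isLittleO_zero _ _).congr_left fun t => ?_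
    rw [Finset.sum_eq_single j]
    · simp [hj]
    · intro l _ hl
      rw [if_neg, smul_zero]
      rw [← hj]
      exact fun h => hl ((S.orderEmbOfFin rfl).injective h.symm)
    · simp
  · refine ((rpow_isLittleO_self (not_le.1 hi)).const_mul_left (α i)).congr_left fun t => ?_
    rw [Finset.sum_eq_zero, sub_zero, smul_eq_mul, mul_comm]
    intro j _
    rw [if_neg, smul_zero]
    intro h
    exact hi (h ▸ hS _ (Finset.orderEmbOfFin_mem S rfl j))

/-- Two little-oh polynomials have expansions with common exponents `0 < a 1 < ⋯ < a n ≤ 1`. -/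
theorem exists_common_expansion {p q : ℝ → ℝ} (hp : IsLittleOhPoly p) (hq : IsLittleOhPoly q) :
    ∃ (n : ℕ) (a α β : Fin n → ℝ), (∀ i, 0 < a i) ∧ StrictMono a ∧ (∀ i, a i ≤ 1) ∧
      ((fun t : ℝ => p t - p 0 - ∑ i, t ^ (a i) • α i) =o[𝓝[>] 0] fun t : ℝ => t) ∧
      ((fun t : ℝ => q t - q 0 - ∑ i, t ^ (a i) • β i) =o[𝓝[>] 0] fun t : ℝ => t) := by
  classical
  obtain ⟨k, α, a, ha, h⟩ := hp
  obtain ⟨l, β, b, hb, h'⟩ := hq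
  set S : Finset ℝ := (Finset.univ.image a ∪ Finset.univ.image b).filter (· ≤ 1) with hS
  have hS1 : ∀ s ∈ S, s ≤ 1 := fun s hs => (Finset.mem_filter.1 hs).2
  have hS0 : ∀ s ∈ S, 0 < s := by
    intro s hs
    have := (Finset.mem_filter.1 hs).1
    simp only [Finset.mem_union, Finset.mem_image, Finset.mem_univ, true_and] at this
    rcases this with ⟨i, rfl⟩ | ⟨i, rfl⟩
    exacts [ha i, hb i]
  obtain ⟨γ, hγ⟩ := exists_coeffs_orderEmb α a S hS1 (fun i hi => by simp [hS, hi])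
  obtain ⟨γ', hγ'⟩ := exists_coeffs_orderEmb β b S hS1 (fun i hi => by simp [hS, hi])
  refine ⟨S.card, S.orderEmbOfFin rfl, γ, γ', fun i => hS0 _ (Finset.orderEmbOfFin_mem S rfl i),
    (S.orderEmbOfFin rfl).strictMono, fun i => hS1 _ (Finset.orderEmbOfFin_mem S rfl i), ?_, ?_⟩
  · exact (h.add hγ).congr_left fun t => by ring
  · exact (h'.add hγ').congr_left fun t => by ring

/-- `z = c t ^ a (1 + u) + o(t)` with `c ≠ 0`, `0 < a ≤ 1` and an infinitesimal `u`. -/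
structure HasLeadingTerm (z : ℝ → ℝ) (c a : ℝ) (u : ℝ → ℝ) : Prop where
  exponent_pos : 0 < a
  exponent_le : a ≤ 1
  poly : IsLittleOhPoly u
  zero : u 0 = 0
  isLittleO : (fun t : ℝ => z t - c * t ^ a * (1 + u t)) =o[𝓝[>] 0] fun t : ℝ => t

theorem hasLeadingTerm_of_expansion {n : ℕ} {a γ : Fin n → ℝ} (ha0 : ∀ i, 0 < a i)
    (ha : StrictMono a) (ha1 : ∀ i, a i ≤ 1) {z : ℝ → ℝ}
    (hz : (fun t : ℝ => z t - ∑ i, t ^ (a i) • γ i) =o[𝓝[>] 0] fun t : ℝ => t)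
    {i : Fin n} (hi : γ i ≠ 0) (hlt : ∀ j < i, γ j = 0) :
    ∃ u, HasLeadingTerm z (γ i) (a i) u := by
  -- terms up to the leading one get the coefficient `0`, and the exponent `1` as a filler
  set b : Fin n → ℝ := fun j => if i < j then a j - a i else 1
  set β : Fin n → ℝ := fun j => if i < j then γ j / γ i else 0
  have hb : ∀ j, 0 < b j := by
    intro j
    by_cases hj : i < j
    · simp [b, hj, ha hj]
    · simp [b, hj]
  refine ⟨fun t => 0 + ∑ j, t ^ (b j) • β j, ha0 i, ha1 i, isLittleOhPoly_sum 0 β b hb, ?_, ?_⟩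
  · rw [zero_add]
    exact Finset.sum_eq_zero fun j _ => by rw [Real.zero_rpow (hb j).ne', zero_smul]
  · refine hz.congr' ?_ EventuallyEq.rfl
    filter_upwards [self_mem_nhdsWithin] with t ht
    have ht' : (0 : ℝ) < t := ht
    congr 1
    rw [zero_add, mul_add, mul_one, Finset.mul_sum, ← Finset.add_sum_erase _ _ (Finset.mem_univ i),
      ← Finset.add_sum_erase (a := i) Finset.univ (fun j => γ i * t ^ a i * t ^ b j • β j)
        (Finset.mem_univ i)]
    have h0 : β i = 0 := by simp [β]
    rw [h0, smul_zero, mul_zero, zero_add, smul_eq_mul, mul_comm (γ i)]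
    congr 1
    refine Finset.sum_congr rfl fun j hj => ?_
    rcases lt_or_gt_of_ne (Finset.ne_of_mem_erase hj) with hj | hj
    · simp [β, hlt j hj]
    · simp only [β, b, hj, if_true, smul_eq_mul]
      rw [Real.rpow_sub ht']
      have := (Real.rpow_pos_of_pos ht' (a i)).ne'
      field_simp

theorem IsLittleOhPoly.exists_leadingTerm {z : ℝ → ℝ} (hz : IsLittleOhPoly z) (h0 : z 0 = 0) :
    z =o[𝓝[>] 0] (fun t : ℝ => t) ∨ ∃ c a u, c ≠ 0 ∧ HasLeadingTerm z c a u := by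
  obtain ⟨n, a, γ, -, ha0, ha, ha1, hγ, -⟩ := exists_common_expansion hz hz
  simp only [h0, sub_zero] at hγ
  by_cases hall : ∀ i, γ i = 0
  · exact Or.inl (by simpa [hall] using hγ)
  · push Not at hall
    obtain ⟨i, hi, hmin⟩ := wellFounded_lt.has_min {i | γ i ≠ 0} hall
    obtain ⟨u, hu⟩ := hasLeadingTerm_of_expansion ha0 ha ha1 hγ hi
      fun j hj => by_contra fun h => hmin j h hj
    exact Or.inr ⟨_, _, u, hi, hu⟩

theorem HasLeadingTerm.neg {z : ℝ → ℝ} {c a : ℝ} {u : ℝ → ℝ} (h : HasLeadingTerm z c a u) :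
    HasLeadingTerm (fun t => -z t) (-c) a u :=
  ⟨h.1, h.2, h.3, h.4, h.5.neg_left.congr_left fun t => by ring⟩

theorem HasLeadingTerm.eventually_pos {z : ℝ → ℝ} {c a : ℝ} {u : ℝ → ℝ}
    (h : HasLeadingTerm z c a u) : ∀ᶠ t in 𝓝[>] (0 : ℝ), 1 / 2 < 1 + u t := by
  have h1 := h.poly.tendsto.const_add 1
  rw [h.zero] at h1
  exact h1.eventually (lt_mem_nhds (by norm_num))

theorem HasLeadingTerm.germLT {z : ℝ → ℝ} {c a : ℝ} {u : ℝ → ℝ} (h : HasLeadingTerm z c a u)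
    (hc : 0 < c) : GermLT 0 z := by
  refine ⟨c / 4, by positivity, ?_⟩
  filter_upwards [h.eventually_pos, isLittleO_iff_abs_le.1 h.isLittleO (c / 4) (by positivity),
    Ioo_mem_nhdsGT (zero_lt_one (α := ℝ))] with t h1 h2 ht
  rw [abs_le] at h2
  have h3 : t ≤ t ^ a := by
    simpa using Real.rpow_le_rpow_of_exponent_ge ht.1 ht.2.le h.exponent_le
  have h4 : c * t * (1 / 2) ≤ c * t ^ a * (1 + u t) :=
    mul_le_mul (by gcongr) h1.le (by norm_num)
      (mul_nonneg hc.le (Real.rpow_nonneg ht.1.le _))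
  simp only [Pi.zero_apply]
  linarith

theorem IsLittleOhPoly.trichotomy {z : ℝ → ℝ} (hz : IsLittleOhPoly z) (h0 : z 0 = 0) :
    z =o[𝓝[>] 0] (fun t : ℝ => t) ∨ GermLT 0 z ∨ GermLT 0 fun t => -z t := by
  rcases hz.exists_leadingTerm h0 with h | ⟨c, a, u, hc, h⟩
  · exact Or.inl h
  · rcases hc.lt_or_gt with hc | hc
    · exact Or.inr (Or.inr (h.neg.germLT (neg_pos.2 hc)))
    · exact Or.inr (Or.inl (h.germLT hc))

/-- Positive infinitesimals have roots: with the leading term factored out, the root is taken of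
`1 + u`, to which Taylor's formula applies. -/
theorem IsLittleOhPoly.exists_root {z : ℝ → ℝ} (hz : IsLittleOhPoly z) (h0 : z 0 = 0)
    (hpos : GermLT 0 z) {m : ℕ} (hm : m ≠ 0) :
    ∃ w : ℝ → ℝ, IsLittleOhPoly w ∧ w 0 = 0 ∧ (∀ᶠ t in 𝓝[>] (0 : ℝ), 0 < w t) ∧
      (fun t => w t ^ m - z t) =o[𝓝[>] 0] fun t : ℝ => t := by
  have hm' : (0 : ℝ) < m := by exact_mod_cast Nat.pos_of_ne_zero hm
  rcases hz.exists_leadingTerm h0 with h | ⟨c, a, u, hc, h⟩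
  · exact absurd (by simpa using h.neg_left) hpos.not_isLittleO
  have hc0 : 0 < c := by
    rcases hc.lt_or_gt with hc | hc
    · have := (h.neg.germLT (neg_pos.2 hc)).neg
      simp only [neg_neg, Pi.zero_apply, neg_zero] at this
      exact absurd this hpos.asymm
    · exact hc
  have ha : 0 < a / m := div_pos h.exponent_pos hm'
  refine ⟨fun t => t ^ (a / m) * (c * (1 + u t)) ^ (1 / m : ℝ), ?_, ?_, ?_, ?_⟩
  · refine (isLittleOhPoly_rpow ha).mul
      (h.poly.comp (f := fun s => (c * (1 + s)) ^ (1 / m : ℝ)) ?_)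
    refine ContDiffAt.rpow_const_of_ne (by fun_prop) ?_
    rw [h.zero]
    simpa using hc
  · simp [Real.zero_rpow ha.ne']
  · filter_upwards [h.eventually_pos, self_mem_nhdsWithin] with t h1 ht
    exact mul_pos (Real.rpow_pos_of_pos ht _) (Real.rpow_pos_of_pos (by nlinarith) _)
  · refine h.isLittleO.neg_left.congr' ?_ EventuallyEq.rfl
    filter_upwards [h.eventually_pos, self_mem_nhdsWithin] with t h1 ht
    have ht' : (0 : ℝ) < t := ht
    have h2 : 0 ≤ c * (1 + u t) := by nlinarith
    rw [mul_pow, ← Real.rpow_mul_natCast ht'.le, ← Real.rpow_mul_natCast h2,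
      div_mul_cancel₀ _ hm'.ne', div_mul_cancel₀ _ hm'.ne', Real.rpow_one]
    ring

/-! ### The order on Fermat reals -/

namespace Fermat

theorem mk_eq_ofCoeffs {p : ℝ → ℝ} (hp : IsLittleOhPoly p) {n : ℕ} {α a : Fin n → ℝ}
    (ha : ∀ i, 0 < a i) : mk p hp = ofCoeffs (p 0) α a ha ↔
      (fun t : ℝ => p t - p 0 - ∑ i, t ^ (a i) • α i) =o[𝓝[>] 0] fun t : ℝ => t := by
  have h0 : ∑ i, (0 : ℝ) ^ (a i) • α i = 0 :=
    Finset.sum_eq_zero fun i _ => by rw [Real.zero_rpow (ha i).ne', zero_smul]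
  rw [ofCoeffs, mk_eq_mk]
  simp only [h0, add_zero, true_and, sub_sub]

theorem germLT_of_toLex_lt {p q : ℝ → ℝ} (hp : IsLittleOhPoly p) (hq : IsLittleOhPoly q) {n : ℕ}
    {a α β : Fin n → ℝ} (ha0 : ∀ i, 0 < a i) (ha : StrictMono a) (ha1 : ∀ i, a i ≤ 1)
    (hα : (fun t : ℝ => p t - p 0 - ∑ i, t ^ (a i) • α i) =o[𝓝[>] 0] fun t : ℝ => t)
    (hβ : (fun t : ℝ => q t - q 0 - ∑ i, t ^ (a i) • β i) =o[𝓝[>] 0] fun t : ℝ => t)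
    (h : toLex (Fin.cons (p 0) α : Fin (n + 1) → ℝ) < toLex (Fin.cons (q 0) β : Fin (n + 1) → ℝ)) :
    GermLT p q := by
  obtain ⟨i, hlt, hi⟩ := h
  induction i using Fin.cases with
  | zero => exact germLT_of_lt hp.tendsto hq.tendsto (by simpa using hi)
  | succ i =>
    have h0 : p 0 = q 0 := by simpa using hlt 0 (Fin.succ_pos i)
    have hj : ∀ j < i, α j = β j := fun j hj => by
      simpa using hlt j.succ (Fin.succ_lt_succ_iff.2 hj)
    have hi' : α i < β i := by simpa using hi
    obtain ⟨u, hu⟩ := hasLeadingTerm_of_expansion (γ := fun j => β j - α j)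
      (z := fun t => q t - p t) ha0 ha ha1
      ((hβ.sub hα).congr_left fun t => by
        simp only [smul_sub, Finset.sum_sub_distrib, h0]; ring)
      (i := i) (sub_ne_zero.2 hi'.ne') fun j hji => sub_eq_zero.2 (hj j hji).symm
    obtain ⟨C, hC, h1⟩ := hu.germLT (sub_pos.2 hi')
    refine ⟨C, hC, ?_⟩
    filter_upwards [h1] with t ht
    simp only [Pi.zero_apply] at ht
    linarith

/-- The dictionary order on Fermat reals compares representatives near `0⁺` up to `o(t)`. -/
theorem mk_lt_mk {p q : ℝ → ℝ} (hp : IsLittleOhPoly p) (hq : IsLittleOhPoly q) :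
    mk p hp < mk q hq ↔ GermLT p q := by
  have key : ∀ {p q : ℝ → ℝ} (hp : IsLittleOhPoly p) (hq : IsLittleOhPoly q),
      mk p hp < mk q hq → GermLT p q := by
    rintro p q hp hq ⟨⟨n, a, α, β, ha0, ha, ha1, hα, hβ, hle⟩, hne⟩
    refine germLT_of_toLex_lt hp hq ha0 ha ha1 ((mk_eq_ofCoeffs hp ha0).1 hα)
      ((mk_eq_ofCoeffs hq ha0).1 hβ) (lt_of_le_of_ne hle fun he => hne ?_)
    have he' := toLex_inj.1 he
    have h1 : std (mk p hp) = std (mk q hq) := (Fin.cons_injective2 he').1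
    rw [hα, hβ, h1, (Fin.cons_injective2 he').2]
  refine ⟨key hp hq, fun h => ?_⟩
  have hne : mk p hp ≠ mk q hq := fun he => h.not_isLittleO ((mk_eq_mk hp hq).1 he).2
  obtain ⟨n, a, α, β, ha0, ha, ha1, hα, hβ⟩ := exists_common_expansion hp hq
  refine ⟨⟨n, a, α, β, ha0, ha, ha1, (mk_eq_ofCoeffs hp ha0).2 hα, (mk_eq_ofCoeffs hq ha0).2 hβ,
    not_lt.1 fun hlt => ?_⟩, hne⟩
  exact h.asymm (germLT_of_toLex_lt hq hp ha0 ha ha1 hβ hα hlt)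

end Fermat

/-! ### The local normal form -/

section NormalForm

variable {E : Type*} [NormedAddCommGroup E] [NormedSpace ℝ E]

/-- If the derivative of order `m` of `h (v₀, ·)` at `x₀` is nonzero, then the terms of order at
least `m` in the Taylor expansion of `h (v, ·)` at `x₀` sum to `± ψ (v, s) ^ m`, up to an error of
arbitrarily high order, with `ψ (v, ·)` a smooth change of variable fixing `0`. -/
theorem exists_normalForm {W : Set (E × ℝ)} (hW : IsOpen W) {h : E × ℝ → ℝ}
    (hh : ContDiffOn ℝ ∞ h W) {v₀ : E} {x₀ : ℝ} (hp : (v₀, x₀) ∈ W) {m n : ℕ} (hm : m ≠ 0)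
    (hn : n ≠ 0) {σ : ℝ} (hσ : σ * σ = 1)
    (hκ : 0 < σ * (dirDeriv (0, (1 : ℝ)))^[m] h (v₀, x₀)) :
    ∃ (ψ : E × ℝ → ℝ) (κ : ℝ), 0 < κ ∧ ContDiffAt ℝ ∞ ψ (v₀, 0) ∧
      HasStrictFDerivAt ψ (κ • ContinuousLinearMap.snd ℝ E ℝ) (v₀, 0) ∧ (∀ v, ψ (v, 0) = 0) ∧
      (fun p : E × ℝ => h (p.1, x₀ + p.2) - ∑ j ∈ Finset.range m,
        (dirDeriv (0, (1 : ℝ)))^[j] h (p.1, x₀) * p.2 ^ j / j.factorial - σ * ψ p ^ m)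
        =O[𝓝 (v₀, 0)] fun p => ‖p.2‖ ^ (m + n) := by
  set D := dirDeriv ((0 : E), (1 : ℝ))
  set P : E × ℝ → ℝ := fun p =>
    ∑ j ∈ Finset.range n, D^[m + j] h (p.1, x₀) * p.2 ^ j / (m + j).factorial with hP
  have hPd : ContDiffAt ℝ ∞ P (v₀, 0) := by
    refine ContDiffAt.sum fun j _ => ContDiffAt.div_const (ContDiffAt.mul ?_ (by fun_prop)) _
    have h1 : ContDiffAt ℝ ∞ (D^[m + j] h) (v₀, x₀) :=
      (hh.iterate_dirDeriv hW _ _).contDiffAt (hW.mem_nhds hp)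
    exact h1.comp (f := fun p : E × ℝ => (p.1, x₀)) (v₀, 0) (by fun_prop)
  have hP0 : 0 < σ * P (v₀, 0) := by
    obtain ⟨n, rfl⟩ := Nat.exists_eq_succ_of_ne_zero hn
    have : P (v₀, 0) = D^[m] h (v₀, x₀) / m.factorial := by
      simp [hP, Finset.sum_range_succ']
    rw [this, ← mul_div_assoc]
    positivity
  set Q : E × ℝ → ℝ := fun p => (σ * P p) ^ (1 / m : ℝ) with hQ
  have hQd : ContDiffAt ℝ ∞ Q (v₀, 0) :=
    (contDiffAt_const.mul hPd).rpow_const_of_ne hP0.ne'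
  have hκ' : 0 < Q (v₀, 0) := Real.rpow_pos_of_pos hP0 _
  have hsnd : HasStrictFDerivAt (fun p : E × ℝ => p.2) (ContinuousLinearMap.snd ℝ E ℝ) (v₀, 0) :=
    hasStrictFDerivAt_snd
  refine ⟨fun p => p.2 * Q p, Q (v₀, 0), hκ', contDiffAt_snd.mul hQd, ?_, by simp, ?_⟩
  · refine (hsnd.mul (hQd.hasStrictFDerivAt (by simp))).congr_fderiv ?_
    ext <;> simp
  · have hpos : ∀ᶠ p in 𝓝 (v₀, (0 : ℝ)), 0 < σ * P p :=
      (continuousAt_const.mul hPd.continuousAt).eventually (lt_mem_nhds hP0)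
    refine (taylorRem_isBigO hW hp (m + n) hh).congr' ?_ EventuallyEq.rfl
    filter_upwards [hpos] with p hpp
    have h3 : Q p ^ m = σ * P p := by
      rw [hQ, ← Real.rpow_mul_natCast hpp.le, div_mul_cancel₀ _ (by exact_mod_cast hm),
        Real.rpow_one]
    rw [taylorRem, Finset.sum_range_add, mul_pow, h3, ← sub_sub,
      show σ * (p.2 ^ m * (σ * P p)) = p.2 ^ m * P p by linear_combination p.2 ^ m * P p * hσ,
      hP, Finset.mul_sum]
    congr 1
    exact Finset.sum_congr rfl fun j _ => by rw [pow_add]; ring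

theorem tendsto_prodMk_of_isLittleOhPoly {v : ℝ → E} (hv : IsLittleOhPoly v) {s : ℝ → ℝ}
    (hs : IsLittleOhPoly s) (hs0 : s 0 = 0) :
    Tendsto (fun t => (v t, s t)) (𝓝[>] 0) (𝓝 (v 0, 0)) := by
  have := hv.tendsto.prodMk_nhds hs.tendsto
  rwa [hs0] at this

/-- The normal form along a curve, when the lower order coefficients are negligible. -/
theorem normalForm_isLittleO {h ψ : E × ℝ → ℝ} {x₀ σ : ℝ} {m n : ℕ} (hm : m ≠ 0)
    {v : ℝ → E} (hv : IsLittleOhPoly v)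
    (hO : (fun p : E × ℝ => h (p.1, x₀ + p.2) - ∑ j ∈ Finset.range m,
        (dirDeriv (0, (1 : ℝ)))^[j] h (p.1, x₀) * p.2 ^ j / j.factorial - σ * ψ p ^ m)
        =O[𝓝 (v 0, 0)] fun p => ‖p.2‖ ^ (m + n))
    (hflat : ∀ j, 0 < j → j < m → (fun t => (dirDeriv (0, (1 : ℝ)))^[j] h (v t, x₀))
      =o[𝓝[>] 0] fun t : ℝ => t)
    {s : ℝ → ℝ} (hs : IsLittleOhPoly s) (hs0 : s 0 = 0)
    (hsn : (fun t => ‖s t‖ ^ n) =o[𝓝[>] 0] fun t : ℝ => t) :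
    (fun t => h (v t, x₀ + s t) - h (v t, x₀) - σ * ψ (v t, s t) ^ m)
      =o[𝓝[>] 0] fun t : ℝ => t := by
  have hs1 : Tendsto s (𝓝[>] 0) (𝓝 0) := by
    have := hs.tendsto
    rwa [hs0] at this
  have h1 := hO.comp_tendsto (tendsto_prodMk_of_isLittleOhPoly hv hs hs0)
  have h2 : (fun t => ‖s t‖ ^ (m + n)) =o[𝓝[>] 0] fun t : ℝ => t := by
    have : (fun t => ‖s t‖ ^ m) =O[𝓝[>] 0] fun _ => (1 : ℝ) :=
      (hs1.norm.pow m).isBigO_one ℝ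
    simpa [pow_add] using this.mul_isLittleO hsn
  obtain ⟨m, rfl⟩ := Nat.exists_eq_succ_of_ne_zero hm
  have h3 : (fun t => ∑ j ∈ Finset.range m, (dirDeriv (0, (1 : ℝ)))^[j + 1] h (v t, x₀) *
      s t ^ (j + 1) / (j + 1).factorial) =o[𝓝[>] 0] fun t : ℝ => t := by
    refine IsLittleO.fun_sum fun j hj => ?_
    have hb : (fun t => s t ^ (j + 1) / ((j + 1).factorial : ℝ)) =O[𝓝[>] 0] fun _ => (1 : ℝ) :=
      ((hs1.pow (j + 1)).div_const _).isBigO_one ℝ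
    have := (hflat (j + 1) j.succ_pos (by simpa using hj)).mul_isBigO hb
    simpa [mul_div_assoc, -Function.iterate_succ] using this
  refine ((h1.trans_isLittleO h2).add h3).congr_left fun t => ?_
  simp only [Function.comp, Nat.succ_eq_add_one, Finset.sum_range_succ',
    Function.iterate_zero_apply, pow_zero, Nat.factorial_zero, Nat.cast_one, div_one, mul_one]
  ring

variable {ψ : E × ℝ → ℝ} {κ : ℝ}

/-- Strict differentiability compares increments of `ψ` in `s` even though `v` moves with `t`. -/
theorem eventually_abs_sub_le {v : ℝ → E} (hv : IsLittleOhPoly v) (hκ : 0 < κ)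
    (hψ : HasStrictFDerivAt ψ (κ • ContinuousLinearMap.snd ℝ E ℝ) (v 0, 0))
    {r s : ℝ → ℝ} (hr : IsLittleOhPoly r) (hr0 : r 0 = 0)
    (hs : IsLittleOhPoly s) (hs0 : s 0 = 0) :
    ∀ᶠ t in 𝓝[>] (0 : ℝ),
      |ψ (v t, s t) - ψ (v t, r t) - κ * (s t - r t)| ≤ κ / 2 * |s t - r t| := by
  have h1 := (hψ.isLittleO.comp_tendsto ((tendsto_prodMk_of_isLittleOhPoly hv hs hs0).prodMk_nhds
    (tendsto_prodMk_of_isLittleOhPoly hv hr hr0))).bound (half_pos hκ)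
  filter_upwards [h1] with t ht
  simpa [Prod.norm_def] using ht

theorem eventually_lt_iff {v : ℝ → E} (hv : IsLittleOhPoly v) (hκ : 0 < κ)
    (hψ : HasStrictFDerivAt ψ (κ • ContinuousLinearMap.snd ℝ E ℝ) (v 0, 0))
    {r s : ℝ → ℝ} (hr : IsLittleOhPoly r) (hr0 : r 0 = 0)
    (hs : IsLittleOhPoly s) (hs0 : s 0 = 0) :
    ∀ᶠ t in 𝓝[>] (0 : ℝ), (ψ (v t, r t) < ψ (v t, s t) ↔ r t < s t) := by
  filter_upwards [eventually_abs_sub_le hv hκ hψ hr hr0 hs hs0] with t ht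
  rw [abs_le] at ht
  constructor
  · intro h1
    by_contra! h2
    rw [abs_of_nonpos (by linarith)] at ht
    nlinarith
  · intro h1
    rw [abs_of_pos (by linarith)] at ht
    nlinarith

theorem isBigO_of_normalForm {v : ℝ → E} (hv : IsLittleOhPoly v) (hκ : 0 < κ)
    (hψ : HasStrictFDerivAt ψ (κ • ContinuousLinearMap.snd ℝ E ℝ) (v 0, 0))
    (hψ0 : ∀ v, ψ (v, 0) = 0) {s : ℝ → ℝ} (hs : IsLittleOhPoly s) (hs0 : s 0 = 0) :
    s =O[𝓝[>] 0] fun t => ψ (v t, s t) := by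
  refine IsBigO.of_bound (2 / κ) ?_
  filter_upwards [eventually_abs_sub_le hv hκ hψ (isLittleOhPoly_const 0) rfl hs hs0] with t ht
  rw [hψ0, sub_zero, sub_zero] at ht
  rw [Real.norm_eq_abs, Real.norm_eq_abs, div_mul_eq_mul_div, le_div_iff₀ hκ]
  have h1 := abs_sub_abs_le_abs_sub (κ * s t) (ψ (v t, s t))
  rw [abs_sub_comm, abs_mul, abs_of_pos hκ] at h1
  linarith

/-- The equation `ψ (v, s) = w` is solved for `s` by the inverse function theorem. -/
theorem exists_isLittleOhPoly_solution [CompleteSpace E] {v : ℝ → E} (hv : IsLittleOhPoly v)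
    (hκ : 0 < κ) (hψd : ContDiffAt ℝ ∞ ψ (v 0, 0))
    (hψ : HasStrictFDerivAt ψ (κ • ContinuousLinearMap.snd ℝ E ℝ) (v 0, 0))
    (hψ0 : ∀ v, ψ (v, 0) = 0) {w : ℝ → ℝ} (hw : IsLittleOhPoly w) (hw0 : w 0 = 0) :
    ∃ s : ℝ → ℝ, IsLittleOhPoly s ∧ s 0 = 0 ∧ ∀ᶠ t in 𝓝[>] (0 : ℝ), ψ (v t, s t) = w t := by
  set e : (E × ℝ) ≃L[ℝ] (E × ℝ) := (ContinuousLinearEquiv.refl ℝ E).prodCongr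
    (ContinuousLinearEquiv.unitsEquivAut ℝ (Units.mk0 κ hκ.ne'))
  set Φ : E × ℝ → E × ℝ := fun p => (p.1, ψ p)
  have hΦ : ContDiffAt ℝ ∞ Φ (v 0, 0) := contDiffAt_fst.prodMk hψd
  have hΦs : HasStrictFDerivAt Φ (e : E × ℝ →L[ℝ] E × ℝ) (v 0, 0) := by
    refine (hasStrictFDerivAt_fst.prodMk hψ).congr_fderiv ?_
    ext <;> simp [e]
  have hΦ0 : Φ (v 0, 0) = (v 0, 0) := by simp [Φ, hψ0]
  have hinv : ContDiffAt ℝ ∞ (hΦs.localInverse Φ e (v 0, 0)) (v 0, 0) := by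
    have := hΦ.to_localInverse hΦs.hasFDerivAt (by simp)
    rwa [hΦ0] at this
  have happ : hΦs.localInverse Φ e (v 0, 0) (v 0, 0) = (v 0, 0) := by
    have := hΦs.localInverse_apply_image
    rwa [hΦ0] at this
  have hright := hΦs.eventually_right_inverse
  rw [hΦ0] at hright
  refine ⟨fun t => (hΦs.localInverse Φ e (v 0, 0) (v t, w t)).2, ?_, ?_, ?_⟩
  · exact (hv.prodMk hw).comp (f := fun p => (hΦs.localInverse Φ e (v 0, 0) p).2)
      (contDiffAt_snd.comp _ (by simpa only [hw0] using hinv))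
  · simp only [hw0, happ]
  · filter_upwards [(tendsto_prodMk_of_isLittleOhPoly hv hw hw0).eventually hright] with t ht
    have h1 := congrArg Prod.fst ht
    have h2 := congrArg Prod.snd ht
    have h3 : (v t, (hΦs.localInverse Φ e (v 0, 0) (v t, w t)).2) =
        hΦs.localInverse Φ e (v 0, 0) (v t, w t) := Prod.ext h1.symm rfl
    rw [h3]
    exact h2

/-- As `h` is locally Lipschitz, a gap in its values that is not `o(t)` comes from such a gap in the
arguments. -/
theorem germLT_of_germLT_comp {h : E × ℝ → ℝ} {v : ℝ → E} {a c : ℝ → ℝ} (hv : IsLittleOhPoly v)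
    (hh : ContDiffAt ℝ ∞ h (v 0, a 0)) (ha : IsLittleOhPoly a) (hc : IsLittleOhPoly c)
    (hac : a 0 = c 0) (hlt : ∀ᶠ t in 𝓝[>] (0 : ℝ), a t < c t)
    (hG : GermLT (fun t => h (v t, a t)) fun t => h (v t, c t)) : GermLT a c := by
  have hc' := hc.tendsto
  rw [← hac] at hc'
  obtain ⟨L, hL, h1⟩ := (((hh.hasStrictFDerivAt (by simp)).isBigO_sub).comp_tendsto
    ((hv.tendsto.prodMk_nhds hc').prodMk_nhds (hv.tendsto.prodMk_nhds ha.tendsto))).exists_pos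
  obtain ⟨C, hC, hG⟩ := hG
  refine ⟨C / L, by positivity, ?_⟩
  filter_upwards [h1.bound, hG, hlt] with t h2 h3 h4
  simp only [Function.comp, Prod.mk_sub_mk, sub_self, Prod.norm_def, norm_zero, Real.norm_eq_abs]
    at h2
  rw [max_eq_right (abs_nonneg _), abs_of_pos (sub_pos.2 h4)] at h2
  have h5 := (le_abs_self _).trans h2
  have h6 : C * t / L ≤ c t - a t := by
    rw [div_le_iff₀ hL]
    linarith
  rw [div_mul_eq_mul_div]
  linarith

end NormalForm

/-- A candidate for the root of `σ z` of order `m`; for even `m` it need only be a root if `σ z` is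
positive. -/
theorem exists_root_candidate {z : ℝ → ℝ} (hz : IsLittleOhPoly z) (h0 : z 0 = 0) {m : ℕ}
    (hm : m ≠ 0) {σ : ℝ} (hσ : σ * σ = 1) :
    ∃ w : ℝ → ℝ, IsLittleOhPoly w ∧ w 0 = 0 ∧
      (Odd m ∧ (fun t => σ * w t ^ m - z t) =o[𝓝[>] 0] (fun t : ℝ => t) ∨
       Even m ∧ (GermLT 0 (fun t => σ * z t) → (∀ᶠ t in 𝓝[>] (0 : ℝ), 0 < w t) ∧
        (fun t => σ * w t ^ m - z t) =o[𝓝[>] 0] fun t : ℝ => t)) := by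
  have hσz : IsLittleOhPoly fun t => σ * z t := (isLittleOhPoly_const σ).mul hz
  have hσz0 : σ * z 0 = 0 := by rw [h0, mul_zero]
  have hmul : ∀ {w : ℝ → ℝ}, (fun t => w t ^ m - σ * z t) =o[𝓝[>] 0] (fun t : ℝ => t) →
      (fun t => σ * w t ^ m - z t) =o[𝓝[>] 0] fun t : ℝ => t := fun {w} h =>
    (h.const_mul_left σ).congr_left fun t => by linear_combination -z t * hσ
  rcases Nat.even_or_odd m with he | ho
  · by_cases hpos : GermLT 0 fun t => σ * z t
    · obtain ⟨w, hw, hw0, hwp, hwm⟩ := hσz.exists_root hσz0 hpos hm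
      exact ⟨w, hw, hw0, Or.inr ⟨he, fun _ => ⟨hwp, hmul hwm⟩⟩⟩
    · exact ⟨_, isLittleOhPoly_const 0, rfl, Or.inr ⟨he, fun h => absurd h hpos⟩⟩
  · rcases hσz.trichotomy hσz0 with h | h | h
    · refine ⟨_, isLittleOhPoly_const 0, rfl, Or.inl ⟨ho, hmul ?_⟩⟩
      simpa [hm] using h.neg_left
    · obtain ⟨w, hw, hw0, -, hwm⟩ := hσz.exists_root hσz0 h hm
      exact ⟨w, hw, hw0, Or.inl ⟨ho, hmul hwm⟩⟩
    · obtain ⟨w, hw, hw0, -, hwm⟩ := hσz.neg.exists_root (by simp [hσz0]) h hm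
      refine ⟨_, hw.neg, by simp [hw0], Or.inl ⟨ho, hmul ?_⟩⟩
      exact hwm.neg_left.congr_left fun t => by rw [ho.neg_pow]; ring

/-- If `z` lies strictly between `σ A ^ m` and `σ B ^ m`, one of the two signs puts the root
of `σ z` between `A` and `B`. -/
theorem exists_root_between {A B z w₀ : ℝ → ℝ} {m : ℕ} {σ : ℝ} (hσ : σ = 1 ∨ σ = -1)
    (hAB : ∀ᶠ t in 𝓝[>] (0 : ℝ), A t < B t) (hA : GermLT (fun t => σ * A t ^ m) z)
    (hB : GermLT z fun t => σ * B t ^ m)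
    (hw : Odd m ∧ (fun t => σ * w₀ t ^ m - z t) =o[𝓝[>] 0] (fun t : ℝ => t) ∨
      Even m ∧ (GermLT 0 (fun t => σ * z t) → (∀ᶠ t in 𝓝[>] (0 : ℝ), 0 < w₀ t) ∧
        (fun t => σ * w₀ t ^ m - z t) =o[𝓝[>] 0] fun t : ℝ => t)) :
    ∃ w : ℝ → ℝ, (w = w₀ ∨ w = fun t => -w₀ t) ∧
      ((fun t => σ * w t ^ m - z t) =o[𝓝[>] 0] fun t : ℝ => t) ∧
      (∀ᶠ t in 𝓝[>] (0 : ℝ), A t < w t) ∧ ∀ᶠ t in 𝓝[>] (0 : ℝ), w t < B t := by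
  have hAw : ∀ {w : ℝ → ℝ}, (fun t => σ * w t ^ m - z t) =o[𝓝[>] 0] (fun t : ℝ => t) →
      ∀ᶠ t in 𝓝[>] (0 : ℝ), σ * A t ^ m < σ * w t ^ m := fun h =>
    (hA.congr (by simp) h).eventually_lt
  have hBw : ∀ {w : ℝ → ℝ}, (fun t => σ * w t ^ m - z t) =o[𝓝[>] 0] (fun t : ℝ => t) →
      ∀ᶠ t in 𝓝[>] (0 : ℝ), σ * w t ^ m < σ * B t ^ m := fun h =>
    (hB.congr h (by simp)).eventually_lt
  rcases hw with ⟨ho, hw⟩ | ⟨he, hw⟩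
  · have hmono := ho.strictMono_pow (R := ℝ)
    refine ⟨w₀, Or.inl rfl, hw, ?_⟩
    rcases hσ with rfl | rfl
    · simp only [one_mul] at hAw hBw hw
      constructor
      · filter_upwards [hAw hw] with t ht using hmono.lt_iff_lt.1 ht
      · filter_upwards [hBw hw] with t ht using hmono.lt_iff_lt.1 ht
    · obtain ⟨t, h1, h2, h3⟩ := (hAB.and ((hAw hw).and (hBw hw))).exists
      have := hmono h1
      simp only at this
      linarith
  · have habs : ∀ {x y : ℝ}, x ^ m < y ^ m → |x| < |y| := fun hxy =>
      lt_of_pow_lt_pow_left₀ m (abs_nonneg _) (by rwa [he.pow_abs, he.pow_abs])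
    rcases hσ with rfl | rfl
    · simp only [one_mul] at *
      obtain ⟨hw0, hw⟩ := hw (GermLT.le_trans (.of_forall fun t => he.pow_nonneg _) hA)
      refine ⟨w₀, Or.inl rfl, hw, ?_, ?_⟩
      · filter_upwards [hAw hw, hw0] with t h1 h2
        exact (le_abs_self _).trans_lt ((habs h1).trans_eq (abs_of_pos h2))
      · filter_upwards [hAw hw, hBw hw, hw0, hAB] with t h1 h2 h3 h4
        have h5 := habs h1
        have h6 := habs h2
        rw [abs_of_pos h3] at h5 h6
        rcases lt_abs.1 h6 with h7 | h7
        · exact h7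
        · linarith [neg_abs_le (A t)]
    · have hpos : GermLT 0 fun t => -1 * z t := by
        refine (hB.neg.congr (p' := fun t => B t ^ m) (q' := fun t => -1 * z t)
          (by simp) (by simp)).le_trans (.of_forall fun t => he.pow_nonneg _)
      obtain ⟨hw0, hw⟩ := hw hpos
      have hneg : (fun t => -1 * (-w₀ t) ^ m - z t) =o[𝓝[>] 0] fun t : ℝ => t := by
        simpa only [he.neg_pow] using hw
      refine ⟨_, Or.inr rfl, hneg, ?_, ?_⟩
      · filter_upwards [hAw hw, hBw hw, hw0, hAB] with t h1 h2 h3 h4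
        have h5 : |w₀ t| < |A t| := habs (by linarith)
        have h6 : |B t| < |w₀ t| := habs (by linarith)
        rw [abs_of_pos h3] at h5 h6
        rcases lt_abs.1 h5 with h7 | h7
        · linarith [le_abs_self (B t)]
        · linarith
      · filter_upwards [hBw hw, hw0] with t h2 h3
        have h6 : |B t| < |w₀ t| := habs (by linarith)
        rw [abs_of_pos h3] at h6
        linarith [neg_abs_le (B t)]

/-- The intermediate value property between two points with the same standard part. In the normal
form, the equation `h (v, x₀ + s) = y` becomes `σ ψ (v, s) ^ m = y - h (v, x₀)`. -/
theorem exists_local_intermediate_value {E : Type*} [NormedAddCommGroup E] [NormedSpace ℝ E]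
    [CompleteSpace E] {W : Set (E × ℝ)} (hW : IsOpen W) {h : E × ℝ → ℝ} (hh : ContDiffOn ℝ ∞ h W)
    {v : ℝ → E} (hv : IsLittleOhPoly v) {x₀ : ℝ} (hp : (v 0, x₀) ∈ W) {m : ℕ} (hm : m ≠ 0)
    (hne : (dirDeriv (0, (1 : ℝ)))^[m] h (v 0, x₀) ≠ 0)
    (hflat : ∀ j, 0 < j → j < m → (fun t => (dirDeriv (0, (1 : ℝ)))^[j] h (v t, x₀))
      =o[𝓝[>] 0] fun t : ℝ => t)
    {a b y : ℝ → ℝ} (ha : IsLittleOhPoly a) (hb : IsLittleOhPoly b) (hy : IsLittleOhPoly y)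
    (ha0 : a 0 = x₀) (hb0 : b 0 = x₀) (hy0 : y 0 = h (v 0, x₀)) (hab : GermLT a b)
    (hay : GermLT (fun t => h (v t, a t)) y) (hyb : GermLT y fun t => h (v t, b t)) :
    ∃ c : ℝ → ℝ, IsLittleOhPoly c ∧ c 0 = x₀ ∧ GermLT a c ∧ GermLT c b ∧
      (fun t => h (v t, c t) - y t) =o[𝓝[>] 0] fun t : ℝ => t := by
  have hhp := hh.contDiffAt (hW.mem_nhds hp)
  obtain ⟨σ, hσ, hκ⟩ : ∃ σ : ℝ, (σ = 1 ∨ σ = -1) ∧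
      0 < σ * (dirDeriv (0, (1 : ℝ)))^[m] h (v 0, x₀) := by
    rcases hne.lt_or_gt with hlt | hgt
    · exact ⟨-1, Or.inr rfl, by linarith⟩
    · exact ⟨1, Or.inl rfl, by linarith⟩
  have hσσ : σ * σ = 1 := by rcases hσ with rfl | rfl <;> norm_num
  have hbase : IsLittleOhPoly fun t => h (v t, x₀) :=
    (hv.prodMk (isLittleOhPoly_const x₀)).comp hhp
  obtain ⟨w₀, hw₀, hw₀0, hcand⟩ :=
    exists_root_candidate (hy.sub hbase) (by rw [hy0, sub_self]) hm hσσ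
  have hδa : IsLittleOhPoly fun t => a t - x₀ := ha0 ▸ ha.sub_zero_val
  have hδb : IsLittleOhPoly fun t => b t - x₀ := hb0 ▸ hb.sub_zero_val
  obtain ⟨n, ⟨hna, hnb, hnw⟩, hn⟩ := ((ha.eventually_pow_isLittleO.and
    (hb.eventually_pow_isLittleO.and hw₀.eventually_pow_isLittleO)).and
      (eventually_ne_atTop 0)).exists
  rw [ha0] at hna
  rw [hb0] at hnb
  rw [hw₀0] at hnw
  simp only [sub_zero] at hnw
  obtain ⟨ψ, κ, hκ0, hψd, hψ, hψ0, hO⟩ := exists_normalForm hW hh hp hm hn hσσ hκ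
  have hform : ∀ {s : ℝ → ℝ}, IsLittleOhPoly s → s 0 = 0 →
      ((fun t => ‖s t‖ ^ n) =o[𝓝[>] 0] fun t : ℝ => t) →
      (fun t => h (v t, x₀ + s t) - h (v t, x₀) - σ * ψ (v t, s t) ^ m)
        =o[𝓝[>] 0] fun t : ℝ => t := normalForm_isLittleO hm hv hO hflat
  have hAB : ∀ᶠ t in 𝓝[>] (0 : ℝ), ψ (v t, a t - x₀) < ψ (v t, b t - x₀) := by
    filter_upwards [eventually_lt_iff hv hκ0 hψ hδa (by simp [ha0]) hδb (by simp [hb0]),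
      hab.eventually_lt] with t h1 h2
    exact h1.2 (by linarith)
  have hsub : ∀ {p q : ℝ → ℝ}, GermLT p q →
      GermLT (fun t => p t - h (v t, x₀)) fun t => q t - h (v t, x₀) := by
    rintro p q ⟨C, hC, hpq⟩
    exact ⟨C, hC, by filter_upwards [hpq] with t ht; linarith⟩
  obtain ⟨w, hww, hwz, hAw, hwB⟩ := exists_root_between hσ hAB
    ((hsub hay).congr ((hform hδa (by simp [ha0]) hna).neg_left.congr_left
      fun t => by rw [add_sub_cancel]; ring) (by simp))
    ((hsub hyb).congr (by simp) ((hform hδb (by simp [hb0]) hnb).neg_left.congr_left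
      fun t => by rw [add_sub_cancel]; ring)) hcand
  have hw : IsLittleOhPoly w ∧ w 0 = 0 ∧ (fun t => ‖w t‖ ^ n) =o[𝓝[>] 0] fun t : ℝ => t := by
    rcases hww with rfl | rfl
    · exact ⟨hw₀, hw₀0, hnw⟩
    · exact ⟨hw₀.neg, by simp [hw₀0], by simpa using hnw⟩
  obtain ⟨s, hs, hs0, hψs⟩ := exists_isLittleOhPoly_solution hv hκ0 hψd hψ hψ0 hw.1 hw.2.1
  have hsw : s =O[𝓝[>] 0] w := (isBigO_of_normalForm hv hκ0 hψ hψ0 hs hs0).trans_eventuallyEq hψs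
  have hc : IsLittleOhPoly fun t => x₀ + s t := (isLittleOhPoly_const x₀).add hs
  have hc0 : x₀ + s 0 = x₀ := by rw [hs0, add_zero]
  have hcy : (fun t => h (v t, x₀ + s t) - y t) =o[𝓝[>] 0] fun t : ℝ => t := by
    refine ((hform hs hs0 ((hsw.norm_norm.pow n).trans_isLittleO hw.2.2)).add hwz).congr' ?_
      EventuallyEq.rfl
    filter_upwards [hψs] with t ht
    rw [ht]
    ring
  have hac : ∀ᶠ t in 𝓝[>] (0 : ℝ), a t < x₀ + s t := by
    filter_upwards [eventually_lt_iff hv hκ0 hψ hδa (by simp [ha0]) hs hs0, hψs, hAw]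
      with t h1 h2 h3
    linarith [h1.1 (by rwa [h2])]
  have hcb : ∀ᶠ t in 𝓝[>] (0 : ℝ), x₀ + s t < b t := by
    filter_upwards [eventually_lt_iff hv hκ0 hψ hs hs0 hδb (by simp [hb0]), hψs, hwB]
      with t h1 h2 h3
    linarith [h1.1 (by rwa [h2])]
  exact ⟨_, hc, hc0,
    germLT_of_germLT_comp hv (ha0 ▸ hhp) ha hc (ha0.trans hc0.symm) hac (hay.congr (by simp) hcy),
    germLT_of_germLT_comp hv (by simpa only [hc0] using hhp) hc hb (hc0.trans hb0.symm) hcb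
      (hyb.congr hcy (by simp)), hcy⟩

/-! ### Crossing points of the standard part -/

/-- `g s` is, for small `s > 0`, at least `C s ^ m` or at most `- C s ^ m` with some `C > 0`. -/
def HasPowerSign (g : ℝ → ℝ) (m : ℕ) : Prop :=
  (∃ C > 0, ∀ᶠ s in 𝓝[>] (0 : ℝ), C * s ^ m ≤ g s) ∨
    ∃ C > 0, ∀ᶠ s in 𝓝[>] (0 : ℝ), g s ≤ -(C * s ^ m)

theorem hasPowerSign_of_isBigO {g : ℝ → ℝ} {κ : ℝ} {m : ℕ} (hκ : κ ≠ 0)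
    (hg : (fun s => g s - κ * s ^ m) =O[𝓝[>] 0] fun s : ℝ => s ^ (m + 1)) : HasPowerSign g m := by
  have hlim : Tendsto (fun s : ℝ => s) (𝓝[>] 0) (𝓝 0) := nhdsWithin_le_nhds
  have h1 : (fun s : ℝ => s ^ (m + 1)) =o[𝓝[>] 0] fun s : ℝ => s ^ m := by
    simpa [pow_succ] using (isBigO_refl (fun s : ℝ => s ^ m) (𝓝[>] 0)).mul_isLittleO
      ((isLittleO_one_iff ℝ).2 hlim)
  have h2 := (hg.trans_isLittleO h1).bound (half_pos (abs_pos.2 hκ))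
  rcases hκ.lt_or_gt with hκ | hκ
  · right
    refine ⟨-κ / 2, by linarith, ?_⟩
    filter_upwards [h2, self_mem_nhdsWithin] with s hs hs0
    have : 0 < s ^ m := pow_pos hs0 m
    rw [Real.norm_eq_abs, abs_le, Real.norm_of_nonneg this.le, abs_of_neg hκ] at hs
    nlinarith
  · left
    refine ⟨κ / 2, by linarith, ?_⟩
    filter_upwards [h2, self_mem_nhdsWithin] with s hs hs0
    have : 0 < s ^ m := pow_pos hs0 m
    rw [Real.norm_eq_abs, abs_le, Real.norm_of_nonneg this.le, abs_of_pos hκ] at hs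
    nlinarith

theorem hasPowerSign_slice {E : Type*} [NormedAddCommGroup E] [NormedSpace ℝ E] {W : Set (E × ℝ)}
    (hW : IsOpen W) {h : E × ℝ → ℝ} (hh : ContDiffOn ℝ ∞ h W) {v₀ : E} {x : ℝ}
    (hp : (v₀, x) ∈ W) {m : ℕ} (hm : m ≠ 0) (hne : (dirDeriv (0, (1 : ℝ)))^[m] h (v₀, x) ≠ 0)
    (hzero : ∀ j, 0 < j → j < m → (dirDeriv (0, (1 : ℝ)))^[j] h (v₀, x) = 0) {r : ℝ}
    (hr : r ≠ 0) : HasPowerSign (fun s => h (v₀, x + r * s) - h (v₀, x)) m := by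
  have hlim : Tendsto (fun s : ℝ => (v₀, r * s)) (𝓝[>] 0) (𝓝 (v₀, 0)) := by
    have : Continuous fun s : ℝ => (v₀, r * s) := by fun_prop
    simpa using (this.tendsto 0).mono_left nhdsWithin_le_nhds
  have h1 := (taylorRem_isBigO hW hp (m + 1) hh).comp_tendsto hlim
  refine hasPowerSign_of_isBigO
    (κ := (dirDeriv (0, (1 : ℝ)))^[m] h (v₀, x) * r ^ m / m.factorial) ?_ ?_
  · exact div_ne_zero (mul_ne_zero hne (pow_ne_zero _ hr)) (by positivity)
  · refine (h1.trans (IsBigO.of_bound (|r| ^ (m + 1)) (.of_forall fun s => ?_))).congr_left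
      fun s => ?_
    · simp [mul_pow]
    · obtain ⟨m, rfl⟩ := Nat.exists_eq_succ_of_ne_zero hm
      have hz : ∑ j ∈ Finset.range m, (dirDeriv (0, (1 : ℝ)))^[j + 1] h (v₀, x) *
          (r * s) ^ (j + 1) / (j + 1).factorial = 0 :=
        Finset.sum_eq_zero fun j hj => by
          rw [hzero (j + 1) j.succ_pos (by simpa using hj), zero_mul, zero_div]
      simp only [Function.comp, taylorRem]
      rw [Finset.sum_range_succ, Finset.sum_range_succ', hz]
      simp only [Nat.succ_eq_add_one, Function.iterate_zero_apply, pow_zero, Nat.factorial_zero,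
        Nat.cast_one, div_one, mul_one, mul_pow]
      ring

/-- If `f a ≤ y ≤ f b`, there is a point where `f` takes the value `y` and crosses it upwards;
nothing is claimed to the left of it if it is `a`, nor to its right if it is `b`. It is the
supremum of the points where `f < y`. -/
theorem exists_crossing {f : ℝ → ℝ} {a b y : ℝ} (hab : a < b) (hf : ContinuousOn f (Icc a b))
    (ha : f a ≤ y) (hb : y ≤ f b)
    (hsign : ∀ x ∈ Icc a b, ∃ m ≠ 0, HasPowerSign (fun s => f (x + 1 * s) - f x) m ∧
      HasPowerSign (fun s => f (x + -1 * s) - f x) m) :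
    ∃ c ∈ Icc a b, f c = y ∧
      (c = a ∨ ∃ m ≠ 0, ∃ C > 0, ∀ᶠ s in 𝓝[>] (0 : ℝ), f (c + -1 * s) ≤ y - C * s ^ m) ∧
      (c = b ∨ ∃ m ≠ 0, ∃ C > 0, ∀ᶠ s in 𝓝[>] (0 : ℝ), y + C * s ^ m ≤ f (c + 1 * s)) := by
  set S : Set ℝ := {x | x ∈ Icc a b ∧ (x = a ∨ f x < y)} with hS
  have haS : a ∈ S := ⟨left_mem_Icc.2 hab.le, Or.inl rfl⟩
  have hSb : BddAbove S := ⟨b, fun x hx => hx.1.2⟩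
  set c := sSup S with hc
  have hlub : IsLUB S c := isLUB_csSup ⟨a, haS⟩ hSb
  have hac : a ≤ c := hlub.1 haS
  have hcb : c ≤ b := hlub.2 fun x hx => hx.1.2
  have hcI : c ∈ Icc a b := ⟨hac, hcb⟩
  have hfc : f c ≤ y := by
    have hcl : IsClosed (Icc a b ∩ f ⁻¹' Iic y) :=
      hf.preimage_isClosed_of_isClosed isClosed_Icc isClosed_Iic
    have hsub : S ⊆ Icc a b ∩ f ⁻¹' Iic y := by
      rintro x ⟨hx, rfl | hx'⟩
      exacts [⟨hx, ha⟩, ⟨hx, hx'.le⟩]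
    exact (hcl.closure_subset_iff.2 hsub (hlub.mem_closure ⟨a, haS⟩)).2
  have hright : ∀ x, c < x → x ≤ b → y ≤ f x := fun x hcx hxb => by
    by_contra! hlt
    exact absurd (hlub.1 (⟨⟨hac.trans hcx.le, hxb⟩, Or.inr hlt⟩ : x ∈ S)) (not_le.2 hcx)
  have hfc' : y ≤ f c := by
    rcases hcb.eq_or_lt with h | h
    · rwa [h]
    · have ht : Tendsto f (𝓝[Ioo c b] c) (𝓝 (f c)) :=
        (hf c hcI).mono fun x hx => ⟨hac.trans hx.1.le, hx.2.le⟩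
      rw [nhdsWithin_Ioo_eq_nhdsGT h] at ht
      refine ge_of_tendsto ht ?_
      filter_upwards [Ioo_mem_nhdsGT h] with x hx using hright x hx.1 hx.2.le
  have hfcy := le_antisymm hfc hfc'
  obtain ⟨m, hm, hR, hL⟩ := hsign c hcI
  rw [hfcy] at hR hL
  refine ⟨c, hcI, hfcy, ?_, ?_⟩
  · rcases hac.eq_or_lt with h | h
    · exact Or.inl h.symm
    right
    rcases hL with ⟨C, hC, hL⟩ | ⟨C, hC, hL⟩
    · exfalso
      obtain ⟨δ, hδ, hL⟩ := mem_nhdsGT_iff_exists_Ioo_subset.1 hL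
      obtain ⟨x, hxS, hx⟩ := hlub.exists_between (max_lt h (sub_lt_self c hδ))
      have hxy : f x < y := hxS.2.resolve_left ((le_max_left _ _).trans_lt hx.1).ne'
      have hxc : x < c := hx.2.lt_of_ne fun he => hxy.ne (he ▸ hfcy)
      have hs := hL (⟨sub_pos.2 hxc, by linarith [(le_max_right _ _).trans_lt hx.1]⟩ :
        c - x ∈ Ioo 0 δ)
      have hpos : 0 < C * (c - x) ^ m := mul_pos hC (pow_pos (sub_pos.2 hxc) _)
      simp only [mem_ofPred_eq, show c + -1 * (c - x) = x by ring] at hs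
      linarith
    · exact ⟨m, hm, C, hC, by filter_upwards [hL] with s hs; linarith⟩
  · rcases hcb.eq_or_lt with h | h
    · exact Or.inl h
    right
    rcases hR with ⟨C, hC, hR⟩ | ⟨C, hC, hR⟩
    · exact ⟨m, hm, C, hC, by filter_upwards [hR] with s hs; linarith⟩
    · exfalso
      obtain ⟨s, hs, hs0⟩ := (hR.and (Ioo_mem_nhdsGT (sub_pos.2 h))).exists
      have hpos : 0 < C * s ^ m := mul_pos hC (pow_pos hs0.1 _)
      have := hright (c + 1 * s) (by linarith [hs0.1]) (by linarith [hs0.2])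
      linarith

section Bracket

variable {E : Type*} [NormedAddCommGroup E] [NormedSpace ℝ E]

theorem IsLittleOhPoly.eventually_germLT_add_rpow {a : ℝ → ℝ} (ha : IsLittleOhPoly a) :
    ∀ᶠ ε in 𝓝[>] (0 : ℝ), GermLT a fun t => a 0 + 1 * t ^ ε := by
  filter_upwards [ha.eventually_isLittleO_rpow, Ioo_mem_nhdsGT (zero_lt_one (α := ℝ))]
    with ε h1 hε
  refine ⟨1 / 2, by norm_num, ?_⟩
  filter_upwards [h1.bound (by norm_num : (0 : ℝ) < 1 / 2),
    Ioo_mem_nhdsGT (zero_lt_one (α := ℝ))] with t h2 ht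
  have h3 : t ≤ t ^ ε := by
    simpa using Real.rpow_le_rpow_of_exponent_ge ht.1 ht.2.le hε.2.le
  rw [Real.norm_eq_abs, abs_le, Real.norm_of_nonneg (Real.rpow_nonneg ht.1.le _)] at h2
  linarith

/-- An increase of `h (v₀, ·)` by `C s ^ m` dominates, at `s = t ^ ε` with small `ε`, the
infinitesimal parts of `v` and `y`. -/
theorem eventually_germLT_of_growth {h : E × ℝ → ℝ} {v : ℝ → E} (hv : IsLittleOhPoly v) {c : ℝ}
    (hh : ContDiffAt ℝ ∞ h (v 0, c)) {y : ℝ → ℝ} (hy : IsLittleOhPoly y) {r : ℝ} {m : ℕ}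
    (hm : m ≠ 0) {C : ℝ} (hC : 0 < C)
    (hgrow : ∀ᶠ s in 𝓝[>] (0 : ℝ), y 0 + C * s ^ m ≤ h (v 0, c + r * s)) :
    ∀ᶠ ε in 𝓝[>] (0 : ℝ), GermLT y fun t => h (v t, c + r * t ^ ε) := by
  have hm0 : (0 : ℝ) < m := by exact_mod_cast Nat.pos_of_ne_zero hm
  have hscale : Tendsto (fun ε : ℝ => ε * m) (𝓝[>] 0) (𝓝[>] 0) := by
    refine tendsto_nhdsWithin_iff.2 ⟨?_, ?_⟩
    · have : Continuous fun ε : ℝ => ε * m := by fun_prop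
      simpa using (this.tendsto 0).mono_left nhdsWithin_le_nhds
    · filter_upwards [self_mem_nhdsWithin] with ε hε using mul_pos hε hm0
  filter_upwards [hscale.eventually hv.eventually_isLittleO_rpow,
    hscale.eventually hy.eventually_isLittleO_rpow,
    hscale.eventually (Ioo_mem_nhdsGT (zero_lt_one (α := ℝ))), self_mem_nhdsWithin]
    with ε hvε hyε hε1 hε
  have hε0 : 0 < ε := hε
  have ht0 : Tendsto (fun t : ℝ => t ^ ε) (𝓝[>] 0) (𝓝[>] 0) := by
    refine tendsto_nhdsWithin_iff.2 ⟨tendsto_rpow_nhdsGT_zero hε0, ?_⟩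
    filter_upwards [self_mem_nhdsWithin] with t ht using Real.rpow_pos_of_pos ht _
  have hx : Tendsto (fun t : ℝ => c + r * t ^ ε) (𝓝[>] 0) (𝓝 c) := by
    simpa using ((tendsto_rpow_nhdsGT_zero hε0).const_mul r).const_add c
  have h1 : (fun t => h (v t, c + r * t ^ ε) - h (v 0, c + r * t ^ ε)) =o[𝓝[>] 0]
      fun t : ℝ => t ^ (ε * m) := by
    have h2 := ((hh.hasStrictFDerivAt (by simp)).isBigO_sub).comp_tendsto
      ((hv.tendsto.prodMk_nhds hx).prodMk_nhds ((tendsto_const_nhds (x := v 0)).prodMk_nhds hx))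
    refine h2.trans_isLittleO (hvε.norm_left.congr_left fun t => ?_).of_norm_left
    simp [Prod.norm_def]
  refine ⟨C / 2, by positivity, ?_⟩
  filter_upwards [h1.bound (show 0 < C / 4 by positivity),
    hyε.bound (show 0 < C / 4 by positivity), ht0.eventually hgrow,
    Ioo_mem_nhdsGT (zero_lt_one (α := ℝ))] with t h2 h3 h4 ht
  rw [Real.norm_eq_abs, abs_le, Real.norm_of_nonneg (Real.rpow_nonneg ht.1.le _)] at h2 h3
  rw [← Real.rpow_mul_natCast ht.1.le] at h4
  have h5 : t ≤ t ^ (ε * m) := by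
    simpa using Real.rpow_le_rpow_of_exponent_ge ht.1 ht.2.le hε1.2.le
  nlinarith

theorem eventually_germLT_of_decay {h : E × ℝ → ℝ} {v : ℝ → E} (hv : IsLittleOhPoly v) {c : ℝ}
    (hh : ContDiffAt ℝ ∞ h (v 0, c)) {y : ℝ → ℝ} (hy : IsLittleOhPoly y) {r : ℝ} {m : ℕ}
    (hm : m ≠ 0) {C : ℝ} (hC : 0 < C)
    (hdecay : ∀ᶠ s in 𝓝[>] (0 : ℝ), h (v 0, c + r * s) ≤ y 0 - C * s ^ m) :
    ∀ᶠ ε in 𝓝[>] (0 : ℝ), GermLT (fun t => h (v t, c + r * t ^ ε)) y := by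
  filter_upwards [eventually_germLT_of_growth (h := fun p => -h p) hv hh.neg hy.neg (r := r) hm hC
    (by filter_upwards [hdecay] with s hs; linarith)] with ε hε
  simpa using hε.neg

theorem isLittleOhPoly_add_rpow (c r : ℝ) {ε : ℝ} (hε : 0 < ε) :
    IsLittleOhPoly fun t : ℝ => c + r * t ^ ε :=
  (isLittleOhPoly_const c).add ((isLittleOhPoly_const r).mul (isLittleOhPoly_rpow hε))

theorem eventually_le_of_zero_lt {p q : ℝ → ℝ} (hp : IsLittleOhPoly p) (hq : IsLittleOhPoly q)
    (h : p 0 < q 0) : ∀ᶠ t in 𝓝[>] (0 : ℝ), p t ≤ q t :=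
  (hp.tendsto.eventually_lt hq.tendsto h).mono fun _ => le_of_lt

/-- If `a` and `b` have different standard parts, the value `y` is bracketed already by two points
between `a` and `b` with the same standard part. -/
theorem exists_infinitesimal_bracket {W : Set (E × ℝ)} (hW : IsOpen W) {h : E × ℝ → ℝ}
    (hh : ContDiffOn ℝ ∞ h W) {v : ℝ → E} (hv : IsLittleOhPoly v) {a b y : ℝ → ℝ}
    (ha : IsLittleOhPoly a) (hb : IsLittleOhPoly b) (hy : IsLittleOhPoly y) (hab : a 0 < b 0)
    (hmem : ∀ x ∈ Icc (a 0) (b 0), (v 0, x) ∈ W)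
    (hord : ∀ x ∈ Icc (a 0) (b 0), ∃ m ≠ 0, (dirDeriv (0, (1 : ℝ)))^[m] h (v 0, x) ≠ 0 ∧
      ∀ j, 0 < j → j < m → (dirDeriv (0, (1 : ℝ)))^[j] h (v 0, x) = 0)
    (hay : GermLT (fun t => h (v t, a t)) y) (hyb : GermLT y fun t => h (v t, b t)) :
    ∃ c ∈ Icc (a 0) (b 0), h (v 0, c) = y 0 ∧ ∃ a' b' : ℝ → ℝ, IsLittleOhPoly a' ∧
      IsLittleOhPoly b' ∧ a' 0 = c ∧ b' 0 = c ∧ (∀ᶠ t in 𝓝[>] (0 : ℝ), a t ≤ a' t) ∧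
      (∀ᶠ t in 𝓝[>] (0 : ℝ), b' t ≤ b t) ∧ GermLT a' b' ∧
      GermLT (fun t => h (v t, a' t)) y ∧ GermLT y fun t => h (v t, b' t) := by
  have hdiff : ∀ x ∈ Icc (a 0) (b 0), ContDiffAt ℝ ∞ h (v 0, x) := fun x hx =>
    hh.contDiffAt (hW.mem_nhds (hmem x hx))
  have hcont : ContinuousOn (fun x => h (v 0, x)) (Icc (a 0) (b 0)) := fun x hx =>
    (ContinuousAt.comp (f := fun x : ℝ => (v 0, x)) (hdiff x hx).continuousAt
      (by fun_prop)).continuousWithinAt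
  have hta := ((hv.prodMk ha).comp (hdiff _ (left_mem_Icc.2 hab.le))).tendsto
  have htb := ((hv.prodMk hb).comp (hdiff _ (right_mem_Icc.2 hab.le))).tendsto
  obtain ⟨c, hc, hcy, hL, hR⟩ := exists_crossing (f := fun x => h (v 0, x)) hab hcont
    (hay.le_of_tendsto hta hy.tendsto) (hyb.le_of_tendsto hy.tendsto htb) fun x hx => by
      obtain ⟨m, hm, hne, hz⟩ := hord x hx
      exact ⟨m, hm, hasPowerSign_slice hW hh (hmem x hx) hm hne hz one_ne_zero,
        hasPowerSign_slice hW hh (hmem x hx) hm hne hz (by norm_num)⟩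
  refine ⟨c, hc, hcy, ?_⟩
  have hcd := hdiff c hc
  have hval : ∀ {r ε : ℝ}, 0 < ε → c + r * (0 : ℝ) ^ ε = c := fun hε => by
    rw [Real.zero_rpow hε.ne', mul_zero, add_zero]
  have hpos : ∀ᶠ ε in 𝓝[>] (0 : ℝ), 0 < ε := self_mem_nhdsWithin
  have hup : ∀ {p : ℝ → ℝ}, IsLittleOhPoly p → p 0 = c →
      ∀ᶠ ε in 𝓝[>] (0 : ℝ), GermLT p fun t => c + 1 * t ^ ε := fun hp hpc =>
    hpc ▸ hp.eventually_germLT_add_rpow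
  have hdown : ∀ {p : ℝ → ℝ}, IsLittleOhPoly p → p 0 = c →
      ∀ᶠ ε in 𝓝[>] (0 : ℝ), GermLT (fun t => c + -1 * t ^ ε) p := fun {p} hp hpc => by
    filter_upwards [hp.neg.eventually_germLT_add_rpow] with ε hε
    refine hε.neg.congr ?_ (by simp)
    simp [hpc, add_comm]
  by_cases hca : c = a 0
  · obtain ⟨m, hm, C, hC, hgrow⟩ := hR.resolve_left (hca ▸ hab.ne)
    obtain ⟨ε, hε, h1, h2⟩ := (hpos.and
      ((eventually_germLT_of_growth hv hcd hy hm hC hgrow).and (hup ha hca.symm))).exists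
    have hb' := isLittleOhPoly_add_rpow c 1 hε
    exact ⟨a, _, ha, hb', hca.symm, hval hε, .of_forall fun _ => le_rfl,
      eventually_le_of_zero_lt hb' hb (by rw [hval hε, hca]; exact hab), h2, hay, h1⟩
  have hac : a 0 < c := lt_of_le_of_ne hc.1 (Ne.symm hca)
  obtain ⟨m, hm, C, hC, hdecay⟩ := hL.resolve_left hca
  by_cases hcb : c = b 0
  · obtain ⟨ε, hε, h1, h2⟩ := (hpos.and
      ((eventually_germLT_of_decay hv hcd hy hm hC hdecay).and (hdown hb hcb.symm))).exists
    have ha' := isLittleOhPoly_add_rpow c (-1) hε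
    exact ⟨_, b, ha', hb, hval hε, hcb.symm,
      eventually_le_of_zero_lt ha ha' (by rw [hval hε]; exact hac), .of_forall fun _ => le_rfl,
      h2, h1, hyb⟩
  have hcb' : c < b 0 := lt_of_le_of_ne hc.2 hcb
  obtain ⟨m', hm', C', hC', hgrow⟩ := hR.resolve_left hcb
  obtain ⟨ε, ⟨hε, h1, h2⟩, h3, h4⟩ := ((hpos.and
      ((eventually_germLT_of_decay hv hcd hy hm hC hdecay).and
        (eventually_germLT_of_growth hv hcd hy hm' hC' hgrow))).and
    ((hdown (isLittleOhPoly_const c) rfl).and (hup (isLittleOhPoly_const c) rfl))).exists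
  have ha' := isLittleOhPoly_add_rpow c (-1) hε
  have hb' := isLittleOhPoly_add_rpow c 1 hε
  exact ⟨_, _, ha', hb', hval hε, hval hε,
    eventually_le_of_zero_lt ha ha' (by rw [hval hε]; exact hac),
    eventually_le_of_zero_lt hb' hb (by rw [hval hε]; exact hcb'),
    h3.trans_le (h4.eventually_lt.mono fun _ => le_of_lt), h1, h2⟩

/-- The intermediate value property in terms of representatives, for increasing values. -/
theorem exists_intermediate_value [CompleteSpace E] {W : Set (E × ℝ)} (hW : IsOpen W)
    {h : E × ℝ → ℝ} (hh : ContDiffOn ℝ ∞ h W) {v : ℝ → E} (hv : IsLittleOhPoly v) {a b y : ℝ → ℝ}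
    (ha : IsLittleOhPoly a) (hb : IsLittleOhPoly b) (hy : IsLittleOhPoly y) (hab : GermLT a b)
    (hmem : ∀ x ∈ Icc (a 0) (b 0), (v 0, x) ∈ W)
    (hord : ∀ x ∈ Icc (a 0) (b 0), ∃ m ≠ 0, (dirDeriv (0, (1 : ℝ)))^[m] h (v 0, x) ≠ 0 ∧
      ∀ j, 0 < j → j < m → (dirDeriv (0, (1 : ℝ)))^[j] h (v 0, x) = 0 ∧
        (fun t => (dirDeriv (0, (1 : ℝ)))^[j] h (v t, x)) =o[𝓝[>] 0] fun t : ℝ => t)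
    (hay : GermLT (fun t => h (v t, a t)) y) (hyb : GermLT y fun t => h (v t, b t)) :
    ∃ c : ℝ → ℝ, IsLittleOhPoly c ∧ c 0 ∈ Icc (a 0) (b 0) ∧ GermLT a c ∧ GermLT c b ∧
      h (v 0, c 0) = y 0 ∧ (fun t => h (v t, c t) - y t) =o[𝓝[>] 0] fun t : ℝ => t := by
  obtain ⟨x₀, hx₀, hxy, a', b', ha', hb', ha0, hb0, haa, hbb, hab', hay', hyb'⟩ :
      ∃ c ∈ Icc (a 0) (b 0), h (v 0, c) = y 0 ∧ ∃ a' b' : ℝ → ℝ, IsLittleOhPoly a' ∧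
      IsLittleOhPoly b' ∧ a' 0 = c ∧ b' 0 = c ∧ (∀ᶠ t in 𝓝[>] (0 : ℝ), a t ≤ a' t) ∧
      (∀ᶠ t in 𝓝[>] (0 : ℝ), b' t ≤ b t) ∧ GermLT a' b' ∧
      GermLT (fun t => h (v t, a' t)) y ∧ GermLT y fun t => h (v t, b' t) := by
    rcases (hab.le_of_tendsto ha.tendsto hb.tendsto).lt_or_eq with hlt | heq
    · refine exists_infinitesimal_bracket hW hh hv ha hb hy hlt hmem (fun x hx => ?_) hay hyb
      obtain ⟨m, hm, hne, hz⟩ := hord x hx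
      exact ⟨m, hm, hne, fun j hj hjm => (hz j hj hjm).1⟩
    · have hd : ContDiffAt ℝ ∞ h (v 0, a 0) :=
        hh.contDiffAt (hW.mem_nhds (hmem _ ⟨le_rfl, heq.le⟩))
      have hta := ((hv.prodMk ha).comp hd).tendsto
      have htb := ((hv.prodMk hb).comp (heq ▸ hd)).tendsto
      refine ⟨a 0, ⟨le_rfl, heq.le⟩, le_antisymm (hay.le_of_tendsto hta hy.tendsto) ?_, a, b, ha,
        hb, rfl, heq.symm, .of_forall fun _ => le_rfl, .of_forall fun _ => le_rfl, hab, hay, hyb⟩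
      rw [heq]
      exact hyb.le_of_tendsto hy.tendsto htb
  obtain ⟨m, hm, hne, hz⟩ := hord x₀ hx₀
  obtain ⟨c, hc, hc0, hac, hcb, hcy⟩ := exists_local_intermediate_value hW hh hv (hmem x₀ hx₀) hm
    hne (fun j hj hjm => (hz j hj hjm).2) ha' hb' hy ha0 hb0 hxy.symm hab' hay' hyb'
  exact ⟨c, hc, hc0 ▸ hx₀, hac.le_trans haa, hcb.trans_le hbb, by rw [hc0, hxy], hcy⟩

end Bracket

/-! ### The intermediate value property -/

theorem Fermat.exists_eq_mk {E : Type*} [NormedAddCommGroup E] [NormedSpace ℝ E] (x : Fermat E) :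
    ∃ (p : ℝ → E) (hp : IsLittleOhPoly p), x = Fermat.mk p hp := by
  obtain ⟨⟨p, hp⟩, rfl⟩ := Quotient.exists_rep x
  exact ⟨p, hp, rfl⟩

/-- A coefficient all of whose derivatives in `v` vanish at the standard part is negligible along
`v`. -/
theorem isLittleO_of_listPartial_eq_zero {d : ℕ} {W : Set (EuclideanSpace ℝ (Fin d) × ℝ)}
    (hW : IsOpen W) {v : ℝ → EuclideanSpace ℝ (Fin d)} (hv : IsLittleOhPoly v) {x : ℝ}
    (hp : (v 0, x) ∈ W) {G : EuclideanSpace ℝ (Fin d) × ℝ → ℝ} (hG : ContDiffOn ℝ ∞ G W)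
    (h : ∀ av, listPartial (fun i => (EuclideanSpace.single i (1 : ℝ), (0 : ℝ)))
      (List.finRange d) av G (v 0, x) = 0) :
    (fun t => G (v t, x)) =o[𝓝[>] 0] fun t : ℝ => t := by
  obtain ⟨n, hn⟩ := hv.eventually_pow_isLittleO.exists
  exact ((isBigO_pow_of_listPartial_eq_zero hW hp n hG h).comp_tendsto hv.tendsto).trans_isLittleO
    hn

theorem mainTheorem3 {d : ℕ} (U : Set ℝ) (hU : IsOpen U) (hUc : IsPreconnected U)
    (V : Set (EuclideanSpace ℝ (Fin d))) (hV : IsOpen V)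
    (h : EuclideanSpace ℝ (Fin d) × ℝ → ℝ) (hh : ContDiffOn ℝ ∞ h (V ×ˢ U))
    (v : Fermat (EuclideanSpace ℝ (Fin d))) (hv : v ∈ Fermat.extSet V)
    (hδ : Fermat.infPart v ≠ 0)
    (hflat : ∀ x ∈ Fermat.extSet U, ∃ m : ℕ, 0 < m ∧
      mixedPartial h 0 m (Fermat.std v, Fermat.std x) ≠ 0)
    (hvanish : ∀ x ∈ Fermat.extSet U, ∀ m : ℕ,
      IsLeast {m : ℕ | 0 < m ∧ mixedPartial h 0 m (Fermat.std v, Fermat.std x) ≠ 0} m →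
      ∀ (av : Fin d → ℕ) (ax : ℕ), 0 < ax → ax < m →
        mixedPartial h av ax (Fermat.std v, Fermat.std x) = 0)
    (g : Fermat.extSet U → Fermat ℝ)
    (hg : ∀ x : Fermat.extSet U, g x =
      Fermat.fermatExt h (V ×ˢ U) (hV.prod hU) hh ⟨Fermat.pair v x.1, Fermat.pair_mem hv x.2⟩) :
    Fermat.HasIVP g := by
  obtain ⟨v, hvp, rfl⟩ := Fermat.exists_eq_mk v
  have hv0 : v 0 ∈ V := hv
  have hW := hV.prod hU
  have hord : ∀ x ∈ U, ∃ m ≠ 0, (dirDeriv (0, (1 : ℝ)))^[m] h (v 0, x) ≠ 0 ∧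
      ∀ j, 0 < j → j < m → (dirDeriv (0, (1 : ℝ)))^[j] h (v 0, x) = 0 ∧
        (fun t => (dirDeriv (0, (1 : ℝ)))^[j] h (v t, x)) =o[𝓝[>] 0] fun t : ℝ => t := by
    classical
    intro x hx
    have hx' : Fermat.mk (fun _ => x) (isLittleOhPoly_const x) ∈ Fermat.extSet U := hx
    have hex := hflat _ hx'
    have hzero := hvanish _ hx' (Nat.find hex) ⟨Nat.find_spec hex, fun k hk => Nat.find_min' hex hk⟩
    have hne := (Nat.find_spec hex).2
    rw [mixedPartial_zero] at hne
    refine ⟨Nat.find hex, (Nat.find_spec hex).1.ne', hne, fun j hj hjm => ⟨?_, ?_⟩⟩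
    · have := hzero 0 j hj hjm
      rwa [mixedPartial_zero] at this
    · exact isLittleO_of_listPartial_eq_zero hW hvp ⟨hv0, hx⟩ (hh.iterate_dirDeriv hW _ j)
        fun av => hzero av j hj hjm
  have hgmk : ∀ (p : ℝ → ℝ) (hp : IsLittleOhPoly p) (hpU : p 0 ∈ U),
      g ⟨Fermat.mk p hp, hpU⟩ = Fermat.mk (fun t => h (v t, p t))
        ((hvp.prodMk hp).comp (hh.contDiffAt (hW.mem_nhds ⟨hv0, hpU⟩))) := fun p hp hpU => by
    rw [hg]
    exact Fermat.fermatExt_mk h _ hW hh _ (hvp.prodMk hp) ⟨hv0, hpU⟩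
  rintro ⟨a, haU⟩ ⟨b, hbU⟩ hab y hy
  obtain ⟨a, ha, rfl⟩ := Fermat.exists_eq_mk a
  obtain ⟨b, hb, rfl⟩ := Fermat.exists_eq_mk b
  obtain ⟨y, hyp, rfl⟩ := Fermat.exists_eq_mk y
  replace hab : GermLT a b := (Fermat.mk_lt_mk ha hb).1 hab
  have hsub : Icc (a 0) (b 0) ⊆ U := hUc.ordConnected.out haU hbU
  have hmem : ∀ x ∈ Icc (a 0) (b 0), (v 0, x) ∈ V ×ˢ U := fun x hx => ⟨hv0, hsub hx⟩
  rw [hgmk a ha haU, hgmk b hb hbU] at hy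
  simp only [Fermat.mk_lt_mk] at hy
  obtain ⟨c, hc, hcm, hac, hcb, hcy0, hcy⟩ : ∃ c : ℝ → ℝ, IsLittleOhPoly c ∧
      c 0 ∈ Icc (a 0) (b 0) ∧ GermLT a c ∧ GermLT c b ∧ h (v 0, c 0) = y 0 ∧
      (fun t => h (v t, c t) - y t) =o[𝓝[>] 0] fun t : ℝ => t := by
    rcases hy with ⟨h1, h2⟩ | ⟨h1, h2⟩
    · exact exists_intermediate_value hW hh hvp ha hb hyp hab hmem
        (fun x hx => hord x (hsub hx)) h1 h2
    -- decreasing values: `-h` satisfies the same hypotheses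
    · obtain ⟨c, hc, hcm, hac, hcb, hcy0, hcy⟩ := exists_intermediate_value (h := -h) hW hh.neg hvp
        ha hb hyp.neg hab hmem (fun x hx => by
          obtain ⟨m, hm, hne, hz⟩ := hord x (hsub hx)
          refine ⟨m, hm, ?_, fun j hj hjm => ?_⟩
          · rw [iterate_dirDeriv_neg]
            exact neg_ne_zero.2 hne
          · rw [iterate_dirDeriv_neg]
            exact ⟨neg_eq_zero.2 (hz j hj hjm).1, (hz j hj hjm).2.neg_left⟩) h2.neg h1.neg
      exact ⟨c, hc, hcm, hac, hcb, neg_inj.1 hcy0, hcy.neg_left.congr_left fun t => by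
        simp only [Pi.neg_apply]; ring⟩
  refine ⟨⟨Fermat.mk c hc, hsub hcm⟩, (Fermat.mk_lt_mk ha hc).2 hac, (Fermat.mk_lt_mk hc hb).2 hcb,
    ?_⟩
  rw [hgmk c hc (hsub hcm)]
  exact (Fermat.mk_eq_mk _ _).2 ⟨hcy0, hcy⟩
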